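/- Let $\mathbb K=\mathbb R$ or $\mathbb C$, let $V$ be a finite-dimensional $\mathbb K$-vector space with a nondegenerate symmetric bilinear form $(\cdot,\cdot)$ (possibly indefinite if $\mathbb K=\mathbb R$), and let $\mathrm{Cl}(V)$ be its Clifford algebra, with the convention $vu+uv=-2(v,u)\mathbf 1$ for $u,v\in V$; identify $\mathfrak{so}(V)$ with the span of the elements $vu-uv$ in $\mathrm{Cl}(V)$. Let $W\neq 0$ be a finite-dimensional $\mathrm{Cl}(V)$-module with a nondegenerate bilinear form $\beta$ that is $\mathfrak{so}(V)$-invariant, is symmetric (put $\epsilon=-1$) or skew-symmetric (put $\epsilon=1$), and satisfies $\beta(v\cdot s,t)=\epsilon\,\beta(s,v\cdot t)$ for all $v\in V$, $s,t\in W$. Let $\mathfrak m=\mathfrak m_{-2}+\mathfrak m_{-1}=V+W$ be the graded Lie algebra whose only nonzero brackets are those of elements $s,t\in W$, with $[s,t]\in V$ given by $([s,t],v)=\beta(v\cdot s,t)$ for all $v\in V$. A transitive prolongation of $\mathfrak m$ is a $\mathbb Z$-graded Lie algebra $\mathfrak g=\bigoplus_{p\in\mathbb Z}\mathfrak g_p$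 over $\mathbb K$ such that every $\mathfrak g_p$ is finite-dimensional; $\bigoplus_{p<0}\mathfrak g_p=\mathfrak m$ as graded Lie algebras (so $\mathfrak g_p=0$ for $p<-2$); and, for all $p\ge 0$, every $X\in\mathfrak g_p$ with $[X,\mathfrak g_{-1}]=0$ is zero. It is maximal if for every transitive prolongation $\mathfrak g'$ of $\mathfrak m$ there is an injective homomorphism of graded Lie algebras $\mathfrak g'\to\mathfrak g$. **Theorem.** Suppose that $\dim V\ge 3$. Then $\mathfrak m$ has a maximal transitive prolongation, and every maximal transitive prolongation $\mathfrak g$ of $\mathfrak m$ satisfies: 1. $\mathfrak g$ is finite-dimensional; 2. for all $p>0$ and all $X\in\mathfrak g_p$, if $[X,\mathfrak g_{-2}]=0$, then $X=0$. -/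

import Mathlib

open scoped DirectSum

universe u v w x

noncomputable section

namespace ExtTranslation

/-- The data defining an extended translation algebra: a nondegenerate symmetric bilinear form
`(·,·)` on `V`, a module structure on `W` over the Clifford algebra of `V` (given as a
representation), and a nondegenerate bilinear form `β` on `W` with the invariance and symmetry
properties listed below.  As `v * v = Q v` in `CliffordAlgebra Q`, taking `Q v = -(v, v)` gives the
convention `v u + u v = -2 (v, u) 1`. -/
structure Datum (K V W : Type*) [RCLike K] [AddCommGroup V] [Module K V]
    [AddCommGroup W] [Module K W] where
  /-- the form `(·,·)` on `V` -/
  form : LinearMap.BilinForm K V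
  form_symm : ∀ u v, form u v = form v u
  form_nondegenerate : form.Nondegenerate
  /-- the action of `Cl(V)` on `W` -/
  act : CliffordAlgebra (-form.toQuadraticMap) →ₐ[K] Module.End K W
  /-- the form `β` on `W` -/
  beta : LinearMap.BilinForm K W
  beta_nondegenerate : beta.Nondegenerate
  /-- `β` is invariant under `𝔰𝔬(V)`, identified with the span of all `v u - u v` in `Cl(V)` -/
  beta_invariant : ∀ A ∈ Submodule.span K
      {A : CliffordAlgebra (-form.toQuadraticMap) | ∃ v u : V,
        A = CliffordAlgebra.ι (-form.toQuadraticMap) v * CliffordAlgebra.ι (-form.toQuadraticMap) u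
          - CliffordAlgebra.ι (-form.toQuadraticMap) u
            * CliffordAlgebra.ι (-form.toQuadraticMap) v},
    ∀ s t, beta (act A s) t + beta s (act A t) = 0
  /-- the sign `ε`: it is `-1` if `β` is symmetric and `1` if `β` is skew-symmetric -/
  eps : K
  beta_symm_or_skew : (eps = -1 ∧ ∀ s t, beta s t = beta t s) ∨
    (eps = 1 ∧ ∀ s t, beta s t = -beta t s)
  beta_clifford : ∀ v s t,
    beta (act (CliffordAlgebra.ι (-form.toQuadraticMap) v) s) t =
      eps * beta s (act (CliffordAlgebra.ι (-form.toQuadraticMap) v) t)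

section Algebra

variable {K V W : Type*} [RCLike K] [AddCommGroup V] [Module K V]
  [AddCommGroup W] [Module K W]

/-- Clifford multiplication `v · s`. -/
def Datum.cl (D : Datum K V W) : V →ₗ[K] Module.End K W :=
  D.act.toLinearMap ∘ₗ CliffordAlgebra.ι (-D.form.toQuadraticMap)

theorem Datum.beta_cl_swap (D : Datum K V W) (v : V) (s t : W) :
    D.beta (D.cl v t) s = -D.beta (D.cl v s) t := by
  have h := D.beta_clifford v t s
  simp only [Datum.cl, LinearMap.comp_apply, AlgHom.toLinearMap_apply] at h ⊢
  rcases D.beta_symm_or_skew with ⟨he, hb⟩ | ⟨he, hb⟩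
  · rw [h, he, hb t]; ring
  · rw [h, he, hb t]; ring

theorem Datum.beta_cl_self (D : Datum K V W) (v : V) (s : W) : D.beta (D.cl v s) s = 0 :=
  CharZero.eq_neg_self_iff.mp (D.beta_cl_swap v s s)

/-- The extended translation algebra `𝔪(V, W, β)`, with underlying vector space `V ⊕ W`. -/
def Datum.Alg (_D : Datum K V W) : Type _ := V × W

instance (D : Datum K V W) : AddCommGroup D.Alg := inferInstanceAs (AddCommGroup (V × W))

instance (D : Datum K V W) : Module K D.Alg := inferInstanceAs (Module K (V × W))

/-- The homogeneous components of `𝔪`: `𝔪₋₂ = V`, `𝔪₋₁ = W`, and `𝔪ₚ = 0` otherwise. -/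
def Datum.grading (D : Datum K V W) (p : ℤ) : Submodule K D.Alg :=
  Submodule.prod (if p = -2 then (⊤ : Submodule K V) else ⊥)
    (if p = -1 then (⊤ : Submodule K W) else ⊥)

theorem Datum.mem_grading (D : Datum K V W) {p : ℤ} {x : D.Alg} :
    x ∈ D.grading p ↔ (p ≠ -2 → x.1 = 0) ∧ (p ≠ -1 → x.2 = 0) := by
  unfold Datum.grading
  refine Submodule.mem_prod.trans ?_
  refine and_congr ?_ ?_
  · split_ifs with h <;> simp [h]
  · split_ifs with h <;> simp [h]

/-- The inclusion of `V` as the component `𝔪₋₂`. -/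
def Datum.inV (D : Datum K V W) : V →ₗ[K] D.grading (-2) where
  toFun v := ⟨((v, 0) : V × W), D.mem_grading.2 ⟨fun h => absurd rfl h, fun _ => rfl⟩⟩
  map_add' _ _ := Subtype.ext (Prod.ext rfl (add_zero (0 : W)).symm)
  map_smul' c _ := Subtype.ext (Prod.ext rfl (smul_zero c).symm)

/-- The inclusion of `W` as the component `𝔪₋₁`. -/
def Datum.inW (D : Datum K V W) : W →ₗ[K] D.grading (-1) where
  toFun s := ⟨((0, s) : V × W), D.mem_grading.2 ⟨fun _ => rfl, fun h => absurd rfl h⟩⟩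
  map_add' _ _ := Subtype.ext (Prod.ext (add_zero (0 : V)).symm rfl)
  map_smul' c _ := Subtype.ext (Prod.ext (smul_zero c).symm rfl)

/-- The decomposition of an element of `𝔪` into its homogeneous components. -/
def Datum.dec (D : Datum K V W) : D.Alg →ₗ[K] ⨁ p, D.grading p where
  toFun x := DirectSum.lof K ℤ (fun p => D.grading p) (-2) (D.inV x.1) +
    DirectSum.lof K ℤ (fun p => D.grading p) (-1) (D.inW x.2)
  map_add' x y := by
    change DirectSum.lof K ℤ (fun p => D.grading p) (-2) (D.inV (x.1 + y.1)) +
      DirectSum.lof K ℤ (fun p => D.grading p) (-1) (D.inW (x.2 + y.2)) = _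
    simp only [map_add]
    abel
  map_smul' c x := by
    change DirectSum.lof K ℤ (fun p => D.grading p) (-2) (D.inV (c • x.1)) +
      DirectSum.lof K ℤ (fun p => D.grading p) (-1) (D.inW (c • x.2)) = _
    simp only [map_smul, smul_add, RingHom.id_apply]

theorem Datum.dec_of_mem (D : Datum K V W) {p : ℤ} (x : D.grading p) :
    D.dec x = DirectSum.lof K ℤ (fun p => D.grading p) p x := by
  obtain ⟨x, hx⟩ := x
  have hx' := D.mem_grading.1 hx
  change DirectSum.lof K ℤ (fun p => D.grading p) (-2) (D.inV x.1) +
    DirectSum.lof K ℤ (fun p => D.grading p) (-1) (D.inW x.2) = _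
  by_cases h2 : p = -2
  · subst h2
    have hs : x.2 = 0 := hx'.2 (by norm_num)
    have e : D.inV x.1 = ⟨x, hx⟩ := Subtype.ext (Prod.ext rfl hs.symm)
    rw [hs, map_zero, map_zero, add_zero, e]
  · have hv : x.1 = 0 := hx'.1 h2
    rw [hv, map_zero, map_zero, zero_add]
    by_cases h1 : p = -1
    · subst h1
      have e : D.inW x.2 = ⟨x, hx⟩ := Subtype.ext (Prod.ext hv.symm rfl)
      rw [e]
    · have hs : x.2 = 0 := hx'.2 h1
      have e : (⟨x, hx⟩ : D.grading p) = 0 := Subtype.ext (Prod.ext hv hs)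
      rw [hs, e, map_zero, map_zero, map_zero]

instance (D : Datum K V W) : DirectSum.Decomposition D.grading :=
  DirectSum.Decomposition.ofLinearMap _ D.dec
    (by
      refine LinearMap.ext fun x => ?_
      change DirectSum.coeLinearMap D.grading
        (DirectSum.lof K ℤ (fun p => D.grading p) (-2) (D.inV x.1) +
          DirectSum.lof K ℤ (fun p => D.grading p) (-1) (D.inW x.2)) = x
      rw [map_add, DirectSum.coeLinearMap_lof, DirectSum.coeLinearMap_lof]
      exact Prod.ext (add_zero x.1) (zero_add x.2))
    (by
      refine DirectSum.linearMap_ext _ fun p => LinearMap.ext fun x => ?_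
      rw [LinearMap.comp_apply, LinearMap.comp_apply, DirectSum.coeLinearMap_lof, D.dec_of_mem]
      rfl)

variable [FiniteDimensional K V]

/-- The bracket `W × W → V`, determined by `([s, t], v) = β(v · s, t)`. -/
def Datum.br (D : Datum K V W) (s t : W) : V :=
  (D.form.toDual D.form_nondegenerate).symm ((D.beta.flip t) ∘ₗ (D.cl.flip s))

theorem Datum.form_br (D : Datum K V W) (s t : W) (v : V) :
    D.form (D.br s t) v = D.beta (D.cl v s) t := by
  simp [Datum.br]

theorem Datum.eq_br (D : Datum K V W) {s t : W} {x : V}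
    (h : ∀ v, D.form x v = D.beta (D.cl v s) t) : x = D.br s t := by
  apply (D.form.toDual D.form_nondegenerate).injective
  ext v
  rw [LinearMap.BilinForm.toDual_def, LinearMap.BilinForm.toDual_def, h, D.form_br]

/-- On `V ⊕ W` the only nonzero brackets are those of two elements of `W`. -/
instance (D : Datum K V W) : Bracket D.Alg D.Alg := ⟨fun x y => (D.br x.2 y.2, (0 : W))⟩

theorem Datum.lie_def (D : Datum K V W) (x y : D.Alg) :
    ⁅x, y⁆ = ((D.br x.2 y.2, (0 : W)) : V × W) := rfl

theorem Datum.br_add_left (D : Datum K V W) (s s' t : W) :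
    D.br (s + s') t = D.br s t + D.br s' t :=
  (D.eq_br fun v => by simp [D.form_br]).symm

theorem Datum.br_add_right (D : Datum K V W) (s t t' : W) :
    D.br s (t + t') = D.br s t + D.br s t' :=
  (D.eq_br fun v => by simp [D.form_br]).symm

theorem Datum.br_smul_right (D : Datum K V W) (c : K) (s t : W) :
    D.br s (c • t) = c • D.br s t :=
  (D.eq_br fun v => by simp [D.form_br]).symm

theorem Datum.br_self (D : Datum K V W) (s : W) : D.br s s = 0 :=
  (D.eq_br fun v => by simp [D.beta_cl_self]).symm

theorem Datum.br_zero_left (D : Datum K V W) (t : W) : D.br 0 t = 0 :=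
  (D.eq_br fun v => by simp).symm

theorem Datum.br_zero_right (D : Datum K V W) (s : W) : D.br s 0 = 0 :=
  (D.eq_br fun v => by simp).symm

instance (D : Datum K V W) : LieRing D.Alg where
  add_lie x y z := Prod.ext (D.br_add_left x.2 y.2 z.2) (add_zero (0 : W)).symm
  lie_add x y z := Prod.ext (D.br_add_right x.2 y.2 z.2) (add_zero (0 : W)).symm
  lie_self x := Prod.ext (D.br_self x.2) rfl
  leibniz_lie x y z := by
    refine Prod.ext ?_ (add_zero (0 : W)).symm
    change D.br x.2 0 = D.br 0 z.2 + D.br y.2 0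
    simp [D.br_zero_left, D.br_zero_right]

instance (D : Datum K V W) : LieAlgebra K D.Alg where
  lie_smul c x y := Prod.ext (D.br_smul_right c x.2 y.2) (smul_zero c).symm

instance (D : Datum K V W) : SetLike.GradedBracket D.grading where
  bracket_mem i j x y hx hy := by
    rw [D.mem_grading] at hx hy ⊢
    refine ⟨fun h => ?_, fun _ => rfl⟩
    change D.br x.2 y.2 = 0
    by_cases hi : i = -1
    · have hj : j ≠ -1 := by omega
      rw [hy.2 hj, D.br_zero_right]
    · rw [hx.2 hi, D.br_zero_left]

instance (D : Datum K V W) : GradedLieAlgebra D.grading where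

end Algebra

/-- `𝔤 = ⨁ₚ 𝔤ₚ` is a transitive prolongation of the graded Lie algebra `𝔪 = 𝔪₋₂ ⊕ 𝔪₋₁`: it has
finite-dimensional components, its negative part is `𝔪`, and an element of nonnegative degree
that commutes with `𝔤₋₁` vanishes. -/
structure IsTransitiveProlongation {K M L : Type*} [Field K]
    [LieRing M] [LieAlgebra K M] (𝓜 : ℤ → Submodule K M)
    [LieRing L] [LieAlgebra K L] (𝓛 : ℤ → Submodule K L) [GradedLieAlgebra 𝓛] : Prop where
  finite (p : ℤ) : FiniteDimensional K (𝓛 p)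
  negative : ∃ j : M →ₗ⁅K⁆ L, Function.Injective j ∧
    (𝓜 (-1)).map (j : M →ₗ[K] L) = 𝓛 (-1) ∧ (𝓜 (-2)).map (j : M →ₗ[K] L) = 𝓛 (-2)
  depth : ∀ p : ℤ, p < -2 → 𝓛 p = ⊥
  transitive : ∀ p : ℤ, 0 ≤ p → ∀ X ∈ 𝓛 p, (∀ w ∈ 𝓛 (-1), ⁅X, w⁆ = 0) → X = 0

/-- `𝔤` is a maximal transitive prolongation of `𝔪`: every transitive prolongation of `𝔪` has an
injective homomorphism of graded Lie algebras into `𝔤`. -/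
structure IsMaximalTransitiveProlongation {K : Type u} {M : Type v} {L : Type w} [Field K]
    [LieRing M] [LieAlgebra K M] (𝓜 : ℤ → Submodule K M)
    [LieRing L] [LieAlgebra K L] (𝓛 : ℤ → Submodule K L) [GradedLieAlgebra 𝓛] : Prop
    extends IsTransitiveProlongation 𝓜 𝓛 where
  maximal : ∀ (L' : Type w) [LieRing L'] [LieAlgebra K L'] (𝓛' : ℤ → Submodule K L')
    [GradedLieAlgebra 𝓛'], IsTransitiveProlongation 𝓜 𝓛' →
      ∃ φ : L' →ₗ⁅K⁆ L, Function.Injective φ ∧ ∀ p, ∀ X ∈ 𝓛' p, φ X ∈ 𝓛 p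

end ExtTranslation

end

noncomputable section

namespace ExtTranslation

/-! ### The Lie algebra of formal vector fields -/

section FormalFields

variable (K : Type*) {M : Type*} [Field K] [LieRing M] [LieAlgebra K M]

/-! Existence. For X in a transitive prolongation 𝔤, record the 𝔪-components of all iterated
brackets [...[[X, y₁], y₂], ..., yₖ] with yᵢ ∈ 𝔪. This is a linear map U(𝔪) → 𝔪, that is, a formal
vector field on the group of 𝔪. The assignment preserves brackets because the nonnegative part of 𝔤
is a subalgebra, and it is injective by transitivity (`ofHom_lie`, `eq_zero_of_ofHom_eq_zero`). The
fields that can arise, sorted by degree, form `prolongation`. It is itself transitive with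
finite-dimensional components because W generates 𝔪 (`span_br`), hence it is maximal.

Faithfulness on V. In a transitive prolongation, an element of degree 0 killing V acts on W by an
endomorphism commuting with products uv of Clifford generators, u non-isotropic
(`commute_of_br_eq_zero`). If X of degree 1 kills V, then Φ(s, t) = [[X, s], t] is symmetric, and
such products pull out of either argument. For orthogonal non-isotropic e₀, e₁, e₂ the products a =
e₀e₁ and b = e₁e₂ anticommute, yet abΦ(s, t) = Φ(as, bt) = baΦ(s, t); so Φ = 0 and X = 0 by
transitivity. Higher degrees follow by induction.

Finiteness. It suffices that 𝔤₄ = 0, since transitivity then kills all higher degrees. Degree 0 acts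
on V by conformal endomorphisms (`exists_conformal`). For X ∈ 𝔤₄ the map (u, v, w) ↦ [[[X, u], v],
w] is symmetric because V is abelian, so it lies in the second prolongation of 𝔠𝔬(V), which is zero
in dimension at least 3 (`second_prolongation_eq_zero`). Thus Y = [X, u] ∈ 𝔤₂ satisfies [[Y, V], V]
= 0. A Clifford computation (`eq_zero_of_cl_mul_add`) gives [Y, V] = 0, and faithfulness on V yields
Y = 0, then X = 0. -/

variable (M) in
/-- The multilinear `M`-valued functions of words in `M` that descend to the universal enveloping
algebra of `M`.  Left-trivialised, these are the formal vector fields on the group of `M`. -/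
def formalFields : Submodule K (List M → M) where
  carrier := {f | (∀ l l' x y, f (l ++ (x + y) :: l') = f (l ++ x :: l') + f (l ++ y :: l')) ∧
    (∀ l l' x, ∀ c : K, f (l ++ (c • x) :: l') = c • f (l ++ x :: l')) ∧
    ∀ l l' x y, f (l ++ ⁅x, y⁆ :: l') = f (l ++ x :: y :: l') - f (l ++ y :: x :: l')}
  zero_mem' := by simp
  add_mem' := by
    rintro f g ⟨h1, h2, h3⟩ ⟨h1', h2', h3'⟩
    refine ⟨fun l l' x y => ?_, fun l l' x c => ?_, fun l l' x y => ?_⟩ <;>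
      simp only [Pi.add_apply, h1, h1', h2, h2', h3, h3', smul_add] <;> abel
  smul_mem' := by
    rintro a f ⟨h1, h2, h3⟩
    refine ⟨fun l l' x y => ?_, fun l l' x c => ?_, fun l l' x y => ?_⟩
    · simp only [Pi.smul_apply, h1, smul_add]
    · simp only [Pi.smul_apply, h2, smul_comm a c]
    · simp only [Pi.smul_apply, h3, smul_sub]

namespace formalFields

variable {K}

theorem ext {X Y : formalFields K M} (h : ∀ l, X.1 l = Y.1 l) : X = Y := Subtype.ext (funext h)

theorem add_apply (X Y : formalFields K M) (l : List M) : (X + Y).1 l = X.1 l + Y.1 l := rfl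

theorem sub_apply (X Y : formalFields K M) (l : List M) : (X - Y).1 l = X.1 l - Y.1 l := rfl

theorem neg_apply (X : formalFields K M) (l : List M) : (-X).1 l = -X.1 l := rfl

theorem smul_apply (c : K) (X : formalFields K M) (l : List M) : (c • X).1 l = c • X.1 l := rfl

/-- The derivative of a formal vector field along an element of `M`. -/
def shift : formalFields K M →ₗ[K] M →ₗ[K] formalFields K M :=
  LinearMap.mk₂ K
    (fun X x => ⟨fun l => X.1 (x :: l), fun l => X.2.1 (x :: l), fun l => X.2.2.1 (x :: l),
      fun l => X.2.2.2 (x :: l)⟩)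
    (fun _ _ _ => rfl) (fun _ _ _ => rfl)
    (fun X x y => ext fun l => X.2.1 [] l x y) (fun c X x => ext fun l => X.2.2.1 [] l x c)

theorem shift_apply (X : formalFields K M) (x : M) (l : List M) :
    (shift X x).1 l = X.1 (x :: l) := rfl

theorem shift_lie (X : formalFields K M) (x y : M) :
    shift X ⁅x, y⁆ = shift (shift X x) y - shift (shift X y) x :=
  ext fun l => X.2.2.2 [] l x y

theorem ext_shift {X Y : formalFields K M} (h0 : X.1 [] = Y.1 []) (h : shift X = shift Y) :
    X = Y := by
  refine ext fun l => ?_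
  cases l with
  | nil => exact h0
  | cons x l => exact congrArg (fun Z : formalFields K M => Z.1 l) (LinearMap.congr_fun h x)

/-- The values of the bracket of two formal vector fields. -/
def brFun : List M → formalFields K M → formalFields K M → M
  -- Value at the origin. Subtracting from X and Y the invariant fields of their values leaves
  -- fields vanishing at the origin, whose bracket must vanish there too; expanding that bracket
  -- gives this formula.
  | [], X, Y => X.1 [Y.1 []] - Y.1 [X.1 []] - ⁅X.1 [], Y.1 []⁆
  | x :: l, X, Y => brFun l (shift X x) Y + brFun l X (shift Y x)

theorem singleton_add (X : formalFields K M) (x y : M) : X.1 [x + y] = X.1 [x] + X.1 [y] :=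
  X.2.1 [] [] x y

theorem singleton_smul (X : formalFields K M) (c : K) (x : M) : X.1 [c • x] = c • X.1 [x] :=
  X.2.2.1 [] [] x c

theorem singleton_neg (X : formalFields K M) (x : M) : X.1 [-x] = -X.1 [x] := by
  simpa using singleton_smul X (-1) x

theorem singleton_sub (X : formalFields K M) (x y : M) : X.1 [x - y] = X.1 [x] - X.1 [y] := by
  rw [sub_eq_add_neg, singleton_add, singleton_neg, sub_eq_add_neg]

theorem singleton_zero (X : formalFields K M) : X.1 [0] = 0 := by
  simpa using singleton_smul X 0 0

theorem singleton_lie (X : formalFields K M) (x y : M) :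
    X.1 [⁅x, y⁆] = X.1 [x, y] - X.1 [y, x] :=
  X.2.2.2 [] [] x y

theorem brFun_swap (l : List M) (X Y : formalFields K M) : brFun l Y X = -brFun l X Y := by
  induction l generalizing X Y with
  | nil =>
    simp only [brFun]
    rw [← lie_skew]
    abel
  | cons x l ih =>
    simp only [brFun]
    rw [ih X (shift Y x), ih (shift X x) Y]
    abel

theorem brFun_add_left (l : List M) (X X' Y : formalFields K M) :
    brFun l (X + X') Y = brFun l X Y + brFun l X' Y := by
  induction l generalizing X X' Y with
  | nil =>
    simp only [brFun, add_apply, singleton_add, add_lie]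
    abel
  | cons x l ih =>
    simp only [brFun, map_add, LinearMap.add_apply, ih]
    abel

theorem brFun_smul_left (l : List M) (c : K) (X Y : formalFields K M) :
    brFun l (c • X) Y = c • brFun l X Y := by
  induction l generalizing X Y with
  | nil => simp only [brFun, smul_apply, singleton_smul, smul_lie, smul_sub]
  | cons x l ih => simp only [brFun, map_smul, LinearMap.smul_apply, ih, smul_add]

/-- The bracket of formal vector fields, as a bilinear map to functions. -/
def brLin (l : List M) : formalFields K M →ₗ[K] formalFields K M →ₗ[K] M :=
  LinearMap.mk₂ K (brFun l) (brFun_add_left l) (brFun_smul_left l)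
    (fun X Y Y' => by
      rw [brFun_swap, brFun_add_left, brFun_swap l X Y, brFun_swap l X Y']; abel)
    (fun c X Y => by rw [brFun_swap, brFun_smul_left, brFun_swap l X Y, smul_neg, neg_neg])

theorem brLin_cons (x : M) (l : List M) (X Y : formalFields K M) :
    brLin (x :: l) X Y = brLin l (shift X x) Y + brLin l X (shift Y x) := rfl

/-- Differentiation acts on the bracket as a derivation, so each relation passes through the leading
letters; at the front it is linearity of `shift` or `shift_lie`. -/
theorem brLin_mem (X Y : formalFields K M) : (fun l => brLin l X Y) ∈ formalFields K M := by
  refine ⟨fun l l' x y => ?_, fun l l' x c => ?_, fun l l' x y => ?_⟩ <;>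
    induction l generalizing X Y with
    | nil =>
      simp only [List.nil_append, brLin_cons, shift_lie, map_add, map_sub, map_smul,
        LinearMap.sub_apply, LinearMap.add_apply, LinearMap.smul_apply, smul_add]
      try abel
    | cons z l ih =>
      simp only [List.cons_append, brLin_cons, smul_add] at ih ⊢
      rw [ih, ih]
      try abel

instance : Bracket (formalFields K M) (formalFields K M) := ⟨fun X Y => ⟨_, brLin_mem X Y⟩⟩

theorem lie_apply (X Y : formalFields K M) (l : List M) : ⁅X, Y⁆.1 l = brLin l X Y := rfl

theorem lie_nil (X Y : formalFields K M) :
    ⁅X, Y⁆.1 [] = X.1 [Y.1 []] - Y.1 [X.1 []] - ⁅X.1 [], Y.1 []⁆ := rfl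

theorem add_lie' (X Y Z : formalFields K M) : ⁅X + Y, Z⁆ = ⁅X, Z⁆ + ⁅Y, Z⁆ :=
  ext fun l => by simp only [lie_apply, add_apply, map_add, LinearMap.add_apply]

theorem lie_add' (X Y Z : formalFields K M) : ⁅X, Y + Z⁆ = ⁅X, Y⁆ + ⁅X, Z⁆ :=
  ext fun l => by simp only [lie_apply, add_apply, map_add]

theorem shift_bracket (X Y : formalFields K M) (x : M) :
    shift ⁅X, Y⁆ x = ⁅shift X x, Y⁆ + ⁅X, shift Y x⁆ := rfl

/-- Both sides are differentiated by the same Leibniz rule, which leaves the empty word. There the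
second derivatives differ only by first derivatives along commutators, and the remainder is the
Jacobi identity of `M`. -/
theorem leibniz (l : List M) (X Y Z : formalFields K M) :
    ⁅X, ⁅Y, Z⁆⁆.1 l = (⁅⁅X, Y⁆, Z⁆ + ⁅Y, ⁅X, Z⁆⁆).1 l := by
  induction l generalizing X Y Z with
  | nil =>
    have hs : ∀ (X Y : formalFields K M) (x : M), ⁅X, Y⁆.1 [x] =
        X.1 [x, Y.1 []] - Y.1 [X.1 [x]] - ⁅X.1 [x], Y.1 []⁆ +
        (X.1 [Y.1 [x]] - Y.1 [x, X.1 []] - ⁅X.1 [], Y.1 [x]⁆) := fun _ _ _ => rfl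
    simp only [add_apply, lie_nil, hs, singleton_sub, sub_lie, lie_sub]
    have hX := singleton_lie X (Y.1 []) (Z.1 [])
    have hY := singleton_lie Y (X.1 []) (Z.1 [])
    have hZ := singleton_lie Z (X.1 []) (Y.1 [])
    have e : ⁅X.1 [], ⁅Y.1 [], Z.1 []⁆⁆ = ⁅⁅X.1 [], Y.1 []⁆, Z.1 []⁆ + ⁅Y.1 [], ⁅X.1 [], Z.1 []⁆⁆ :=
      leibniz_lie _ _ _
    rw [hX, hY, hZ, e, ← lie_skew (Y.1 [X.1 []]) (Z.1 []), ← lie_skew (X.1 [Y.1 []]) (Z.1 []),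
      ← lie_skew (X.1 [Z.1 []]) (Y.1 [])]
    abel
  | cons x l ih =>
    have h : (shift ⁅X, ⁅Y, Z⁆⁆ x).1 l = (shift (⁅⁅X, Y⁆, Z⁆ + ⁅Y, ⁅X, Z⁆⁆) x).1 l := by
      simp only [map_add, LinearMap.add_apply, shift_bracket, add_lie', lie_add', add_apply]
      rw [ih (shift X x), ih X (shift Y x), ih X Y (shift Z x)]
      simp only [add_apply]
      abel
    exact h

/-! ### Formal vector fields attached to elements of a Lie algebra over `M` -/

section OfHom

variable {L : Type*} [LieRing L] [LieAlgebra K L]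

/-- The iterated right bracket with the images of the letters of a word. -/
def iterLie (j : M →ₗ⁅K⁆ L) : List M → L →ₗ[K] L
  | [] => LinearMap.id
  | x :: l => iterLie j l ∘ₗ LinearMap.flip (LieModule.toEnd K L L : L →ₗ[K] Module.End K L) (j x)

theorem iterLie_cons (j : M →ₗ⁅K⁆ L) (x : M) (l : List M) (X : L) :
    iterLie j (x :: l) X = iterLie j l ⁅X, j x⁆ := rfl

theorem iterLie_append (j : M →ₗ⁅K⁆ L) (l l' : List M) (X : L) :
    iterLie j (l ++ l') X = iterLie j l' (iterLie j l X) := by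
  induction l generalizing X with
  | nil => rfl
  | cons x l ih => exact ih _

/-- The formal vector field of an element of a Lie algebra `L` over `M`, obtained by projecting
its iterated brackets to `M`. -/
def ofHom (j : M →ₗ⁅K⁆ L) (π : L →ₗ[K] M) : L →ₗ[K] formalFields K M where
  toFun X := ⟨fun l => π (iterLie j l X), by
    refine ⟨fun l l' x y => ?_, fun l l' x c => ?_, fun l l' x y => ?_⟩ <;>
      simp only [iterLie_append, iterLie_cons]
    · simp only [map_add, lie_add]
    · simp only [map_smul, lie_smul]
    · generalize iterLie j l X = b
      have e : ⁅b, ⁅j x, j y⁆⁆ = ⁅⁅b, j x⁆, j y⁆ - ⁅⁅b, j y⁆, j x⁆ := by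
        rw [leibniz_lie, ← lie_skew ⁅b, j y⁆]; abel
      rw [LieHom.map_lie, e, map_sub, map_sub]⟩
  map_add' X Y := ext fun l => by simp only [add_apply, map_add]
  map_smul' c X := ext fun l => by simp only [smul_apply, map_smul, RingHom.id_apply]

theorem shift_ofHom (j : M →ₗ⁅K⁆ L) (π : L →ₗ[K] M) (X : L) (x : M) :
    shift (ofHom j π X) x = ofHom j π ⁅X, j x⁆ := rfl

/-- `ofHom` preserves brackets if the kernel of the projection is a subalgebra. -/
theorem ofHom_lie (j : M →ₗ⁅K⁆ L) (π : L →ₗ[K] M) (hj : ∀ y, π (j y) = y)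
    (hπ : ∀ X Y, π X = 0 → π Y = 0 → π ⁅X, Y⁆ = 0) (X Y : L) :
    ofHom j π ⁅X, Y⁆ = ⁅ofHom j π X, ofHom j π Y⁆ := by
  refine ext fun l => ?_
  induction l generalizing X Y with
  | nil =>
    -- Both arguments lie in the kernel of `π`; expanding this relation reproduces the formula for
    -- the bracket on the empty word.
    have h := hπ (X - j (π X)) (Y - j (π Y)) (by simp [hj]) (by simp [hj])
    change π ⁅X, Y⁆ = π ⁅X, j (π Y)⁆ - π ⁅Y, j (π X)⁆ - ⁅π X, π Y⁆
    rw [← lie_skew Y, map_neg]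
    simp only [sub_lie, lie_sub, map_sub, ← LieHom.map_lie, hj] at h
    rw [sub_sub, sub_eq_zero] at h
    rw [h]
    abel
  | cons x l ih =>
    change (ofHom j π ⁅⁅X, Y⁆, j x⁆).1 l = (shift ⁅ofHom j π X, ofHom j π Y⁆ x).1 l
    rw [shift_bracket, add_apply, shift_ofHom, shift_ofHom, ← ih, ← ih, ← add_apply, ← map_add,
      lie_lie, sub_eq_add_neg, lie_skew, add_comm]

end OfHom

/-- The invariant vector field of an element of `M`. -/
def ofAlg : M →ₗ[K] formalFields K M := ofHom LieHom.id LinearMap.id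

theorem ofAlg_nil (y : M) : (ofAlg y : formalFields K M).1 [] = y := rfl

theorem shift_ofAlg (y x : M) : shift (ofAlg y : formalFields K M) x = ofAlg ⁅y, x⁆ := rfl

theorem ofAlg_injective : Function.Injective (ofAlg : M →ₗ[K] formalFields K M) := fun _ _ h =>
  congrArg (fun Z : formalFields K M => Z.1 []) h

theorem ofHom_map {L : Type*} [LieRing L] [LieAlgebra K L] (j : M →ₗ⁅K⁆ L) (π : L →ₗ[K] M)
    (hj : ∀ y, π (j y) = y) (y : M) : ofHom j π (j y) = ofAlg y := by
  refine ext fun l => ?_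
  induction l generalizing y with
  | nil => exact hj y
  | cons x l ih =>
    change (ofHom j π ⁅j y, j x⁆).1 l = (ofAlg ⁅y, x⁆ : formalFields K M).1 l
    rw [← LieHom.map_lie, ih]

/-- Turns differentiation along 𝔪 into a bracket inside the Lie algebra of fields, so that
conditions on derivatives are conditions on brackets with the negative part. -/
theorem lie_ofAlg (X : formalFields K M) (y : M) :
    ⁅X, (ofAlg y : formalFields K M)⁆ = shift X y := by
  refine ext fun l => ?_
  induction l generalizing X y with
  | nil =>
    rw [lie_nil, ofAlg_nil, shift_apply]
    change X.1 [y] - ⁅y, X.1 []⁆ - ⁅X.1 [], y⁆ = X.1 [y]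
    rw [← lie_skew]
    abel
  | cons x l ih =>
    change (shift ⁅X, (ofAlg y : formalFields K M)⁆ x).1 l = (shift (shift X y) x).1 l
    rw [shift_bracket, add_apply, ih, shift_ofAlg, ih, shift_lie, sub_apply]
    abel

/-- The vector field of a derivation of `M`. -/
def ofDerivation (d : LieDerivation K M M) : formalFields K M :=
  ⟨fun l => match l with
    | [] => 0
    | x :: l => (ofAlg (d x) : formalFields K M).1 l, by
    refine ⟨fun l l' x z => ?_, fun l l' x c => ?_, fun l l' x z => ?_⟩ <;> cases l
    · simp only [List.nil_append, map_add, add_apply]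
    · exact (ofAlg _ : formalFields K M).2.1 _ _ _ _
    · simp only [List.nil_append, map_smul, smul_apply]
    · exact (ofAlg _ : formalFields K M).2.2.1 _ _ _ _
    · simp only [List.nil_append, LieDerivation.apply_lie_eq_sub, map_sub, sub_apply]
      rw [← lie_skew x (d z), ← lie_skew z (d x), map_neg, map_neg, neg_apply, neg_apply]
      change _ = (ofAlg ⁅d x, z⁆ : formalFields K M).1 l' - (ofAlg ⁅d z, x⁆ : formalFields K M).1 l'
      abel
    · exact (ofAlg _ : formalFields K M).2.2.2 _ _ _ _⟩

theorem ofDerivation_nil (d : LieDerivation K M M) :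
    (ofDerivation d : formalFields K M).1 [] = 0 := rfl

theorem shift_ofDerivation (d : LieDerivation K M M) (x : M) :
    shift (ofDerivation d : formalFields K M) x = ofAlg (d x) := rfl

variable [CharZero K]

instance : LieRing (formalFields K M) where
  add_lie := add_lie'
  lie_add := lie_add'
  lie_self X := ext fun l => by
    have h : brLin l X X = -brLin l X X := brFun_swap l X X
    have h2 : (2 : K) • brLin l X X = 0 := by rw [two_smul]; nth_rw 1 [h]; simp
    exact (smul_eq_zero.1 h2).resolve_left two_ne_zero
  leibniz_lie X Y Z := ext fun l => leibniz l X Y Z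

instance : LieAlgebra K (formalFields K M) where
  lie_smul c X Y := ext fun l => map_smul (brLin l X) c Y

variable (K M) in
/-- The embedding of `M` into formal vector fields. -/
def ofAlgHom : M →ₗ⁅K⁆ formalFields K M :=
  { ofAlg with
    map_lie' := fun {x y} => by
      change (ofAlg ⁅x, y⁆ : formalFields K M) = ⁅ofAlg x, ofAlg y⁆
      rw [lie_ofAlg, shift_ofAlg] }

end formalFields

end FormalFields

end ExtTranslation
end

noncomputable section

namespace ExtTranslation

/-! ### The maximal prolongation inside the formal vector fields -/

section Prolongation

open formalFields

/-- Differentiating along a negative element strictly lowers the degree, so negative degrees serve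
as the base of a strong induction. -/
theorem degree_induction {P : ℤ → Prop} (neg : ∀ p < 0, P p)
    (nonneg : ∀ p, 0 ≤ p → (∀ q < 0, P (p + q)) → P p) (p : ℤ) : P p := by
  have key : ∀ n : ℕ, ∀ p : ℤ, p < n → P p := by
    intro n
    induction n with
    | zero => exact fun p hp => neg p (by simpa using hp)
    | succ n ih =>
      intro p hp
      rcases lt_or_ge p 0 with h | h
      · exact neg p h
      · exact nonneg p h fun q hq => ih _ (by push_cast at hp; omega)
  exact key (p.toNat + 1) p (by push_cast; have := Int.self_le_toNat p; omega)

variable {K M : Type*} [Field K] [LieRing M] [LieAlgebra K M]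
  (𝓜 : ℤ → Submodule K M)

/-- The formal vector fields of degree `p` whose iterated derivatives of negative degree are
invariant. -/
inductive IsProlongation : ℤ → formalFields K M → Prop
  | neg (p : ℤ) (y : M) : p < 0 → y ∈ 𝓜 p → IsProlongation p (ofAlg y)
  | nonneg (p : ℤ) (X : formalFields K M) : 0 ≤ p → X.1 [] = 0 →
      (∀ q < 0, ∀ y ∈ 𝓜 q, IsProlongation (p + q) (shift X y)) → IsProlongation p X

variable {𝓜}

theorem isProlongation_of_neg {p : ℤ} (hp : p < 0) {X : formalFields K M} :
    IsProlongation 𝓜 p X ↔ ∃ y ∈ 𝓜 p, ofAlg y = X := by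
  constructor
  · rintro (⟨_, y, _, hy⟩ | ⟨_, _, h, _⟩)
    · exact ⟨y, hy, rfl⟩
    · omega
  · rintro ⟨y, hy, rfl⟩
    exact .neg p y hp hy

theorem isProlongation_of_nonneg {p : ℤ} (hp : 0 ≤ p) {X : formalFields K M} :
    IsProlongation 𝓜 p X ↔
      X.1 [] = 0 ∧ ∀ q < 0, ∀ y ∈ 𝓜 q, IsProlongation 𝓜 (p + q) (shift X y) := by
  constructor
  · rintro (⟨_, y, h, _⟩ | ⟨_, _, _, h0, h⟩)
    · omega
    · exact ⟨h0, h⟩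
  · rintro ⟨h0, h⟩
    exact .nonneg p X hp h0 h

variable (𝓜) in
/-- The component of degree `p` of the maximal prolongation. -/
def prolong (p : ℤ) : Submodule K (formalFields K M) where
  carrier := {X | IsProlongation 𝓜 p X}
  zero_mem' := by
    refine degree_induction (P := fun p => IsProlongation 𝓜 p 0) (fun p hp => ?_) (fun p hp ih => ?_) p
    · exact (isProlongation_of_neg hp).2 ⟨0, zero_mem _, map_zero _⟩
    · refine (isProlongation_of_nonneg hp).2 ⟨rfl, fun q hq y _ => ?_⟩
      simpa using ih q hq
  add_mem' := by
    refine degree_induction (P := fun p => ∀ {X Y}, IsProlongation 𝓜 p X → IsProlongation 𝓜 p Y →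
      IsProlongation 𝓜 p (X + Y)) (fun p hp X Y hX hY => ?_) (fun p hp ih X Y hX hY => ?_) p
    · obtain ⟨x, hx, rfl⟩ := (isProlongation_of_neg hp).1 hX
      obtain ⟨y, hy, rfl⟩ := (isProlongation_of_neg hp).1 hY
      exact (isProlongation_of_neg hp).2 ⟨x + y, add_mem hx hy, map_add _ _ _⟩
    · obtain ⟨hX0, hX⟩ := (isProlongation_of_nonneg hp).1 hX
      obtain ⟨hY0, hY⟩ := (isProlongation_of_nonneg hp).1 hY
      refine (isProlongation_of_nonneg hp).2 ⟨by rw [formalFields.add_apply, hX0, hY0, add_zero],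
        fun q hq y hy => ?_⟩
      rw [map_add]
      exact ih q hq (hX q hq y hy) (hY q hq y hy)
  smul_mem' c := by
    refine degree_induction (P := fun p => ∀ {X}, IsProlongation 𝓜 p X →
      IsProlongation 𝓜 p (c • X)) (fun p hp X hX => ?_) (fun p hp ih X hX => ?_) p
    · obtain ⟨x, hx, rfl⟩ := (isProlongation_of_neg hp).1 hX
      exact (isProlongation_of_neg hp).2 ⟨c • x, Submodule.smul_mem _ c hx, map_smul _ _ _⟩
    · obtain ⟨hX0, hX⟩ := (isProlongation_of_nonneg hp).1 hX
      refine (isProlongation_of_nonneg hp).2 ⟨by rw [formalFields.smul_apply, hX0, smul_zero],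
        fun q hq y hy => ?_⟩
      rw [map_smul]
      exact ih q hq (hX q hq y hy)

theorem mem_prolong_of_neg {p : ℤ} (hp : p < 0) {X : formalFields K M} :
    X ∈ prolong 𝓜 p ↔ ∃ y ∈ 𝓜 p, ofAlg y = X := isProlongation_of_neg hp

theorem mem_prolong_of_nonneg {p : ℤ} (hp : 0 ≤ p) {X : formalFields K M} :
    X ∈ prolong 𝓜 p ↔ X.1 [] = 0 ∧ ∀ q < 0, ∀ y ∈ 𝓜 q, shift X y ∈ prolong 𝓜 (p + q) :=
  isProlongation_of_nonneg hp

variable [GradedLieAlgebra 𝓜]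

theorem linearMap_ext_of_neg {N : Type*} [AddCommGroup N] [Module K N]
    (h𝓜 : ∀ p, 0 ≤ p → 𝓜 p = ⊥) {f g : M →ₗ[K] N} (h : ∀ q < 0, ∀ y ∈ 𝓜 q, f y = g y) :
    f = g := by
  refine LinearMap.ext fun y => ?_
  induction y using DirectSum.Decomposition.inductionOn 𝓜 with
  | zero => simp
  | @homogeneous q y =>
    rcases lt_or_ge q 0 with hq | hq
    · exact h q hq y y.2
    · have : (y : M) = 0 := by simpa [h𝓜 q hq] using y.2
      simp [this]
  | add x y hx hy => rw [map_add, map_add, hx, hy]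

theorem shift_mem_prolong {p q : ℤ} (hq : q < 0) {X : formalFields K M} (hX : X ∈ prolong 𝓜 p)
    {y : M} (hy : y ∈ 𝓜 q) : shift X y ∈ prolong 𝓜 (p + q) := by
  rcases lt_or_ge p 0 with hp | hp
  · obtain ⟨x, hx, rfl⟩ := (mem_prolong_of_neg hp).1 hX
    exact (mem_prolong_of_neg (by omega)).2
      ⟨⁅x, y⁆, SetLike.GradedBracket.bracket_mem hx hy, rfl⟩
  · exact ((mem_prolong_of_nonneg hp).1 hX).2 q hq y hy

variable (𝓜) in
/-- The grading element. -/
def eulerField : formalFields K M :=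
  ofDerivation (LieDerivation.ofGrading 𝓜 (Int.castAddHom K))

theorem shift_eulerField {q : ℤ} {y : M} (hy : y ∈ 𝓜 q) :
    shift (eulerField 𝓜) y = (q : K) • ofAlg y := by
  rw [eulerField, shift_ofDerivation, LieDerivation.ofGrading_apply_apply 𝓜 _ hy, map_smul]
  rfl

theorem eulerField_mem : eulerField 𝓜 ∈ prolong 𝓜 0 := by
  refine (mem_prolong_of_nonneg le_rfl).2 ⟨rfl, fun q hq y hy => ?_⟩
  rw [shift_eulerField hy, zero_add]
  exact Submodule.smul_mem _ _ ((mem_prolong_of_neg hq).2 ⟨y, hy, rfl⟩)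

variable [CharZero K]

/-- If one degree is negative, the bracket is up to sign a derivative. If both are nonnegative, both
fields vanish at the origin, hence so does the bracket, and its derivatives are brackets of smaller
total degree. -/
theorem lie_mem_prolong {p q : ℤ} {X Y : formalFields K M} (hX : X ∈ prolong 𝓜 p)
    (hY : Y ∈ prolong 𝓜 q) : ⁅X, Y⁆ ∈ prolong 𝓜 (p + q) := by
  obtain ⟨r, hr⟩ : ∃ r, r = p + q := ⟨_, rfl⟩
  induction r using degree_induction generalizing p q X Y with
  | neg r _ =>
    rcases lt_or_ge q 0 with hq | hq
    · obtain ⟨y, hy, rfl⟩ := (mem_prolong_of_neg hq).1 hY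
      rw [lie_ofAlg]
      exact shift_mem_prolong hq hX hy
    · have hp : p < 0 := by omega
      obtain ⟨x, hx, rfl⟩ := (mem_prolong_of_neg hp).1 hX
      rw [← lie_skew, lie_ofAlg, add_comm]
      exact neg_mem (shift_mem_prolong hp hY hx)
  | nonneg r hr0 ih =>
    rcases lt_or_ge q 0 with hq | hq
    · obtain ⟨y, hy, rfl⟩ := (mem_prolong_of_neg hq).1 hY
      rw [lie_ofAlg]
      exact shift_mem_prolong hq hX hy
    rcases lt_or_ge p 0 with hp | hp
    · obtain ⟨x, hx, rfl⟩ := (mem_prolong_of_neg hp).1 hX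
      rw [← lie_skew, lie_ofAlg, add_comm]
      exact neg_mem (shift_mem_prolong hp hY hx)
    refine (mem_prolong_of_nonneg (by omega)).2 ⟨?_, fun s hs y hy => ?_⟩
    · rw [lie_nil, ((mem_prolong_of_nonneg hp).1 hX).1, ((mem_prolong_of_nonneg hq).1 hY).1,
        singleton_zero, singleton_zero, lie_zero, sub_zero, sub_zero]
    · rw [shift_bracket]
      refine add_mem ?_ ?_
      · rw [show p + q + s = p + s + q by ring]
        exact ih s hs (shift_mem_prolong hs hX hy) hY (by omega)
      · rw [add_assoc]
        exact ih s hs hX (shift_mem_prolong hs hY hy) (by omega)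

/-- Both sides vanish at the origin when p ≥ 0. Along y of degree q, the derivative of the left side
is −q + (p + q) = p times the derivative of X. -/
theorem eulerField_lie (h𝓜 : ∀ p, 0 ≤ p → 𝓜 p = ⊥) {p : ℤ} {X : formalFields K M}
    (hX : X ∈ prolong 𝓜 p) : ⁅eulerField 𝓜, X⁆ = (p : K) • X := by
  induction p using degree_induction generalizing X with
  | neg p hp =>
    obtain ⟨y, hy, rfl⟩ := (mem_prolong_of_neg hp).1 hX
    rw [lie_ofAlg, shift_eulerField hy]
  | nonneg p hp ih =>
    have hX' := (mem_prolong_of_nonneg hp).1 hX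
    refine ext_shift ?_ (linearMap_ext_of_neg h𝓜 fun q hq y hy => ?_)
    · rw [lie_nil, hX'.1, formalFields.smul_apply, hX'.1, singleton_zero, smul_zero, lie_zero, eulerField,
        ofDerivation_nil, singleton_zero, sub_zero, sub_zero]
    · rw [shift_bracket, shift_eulerField hy, smul_lie, ← lie_skew, lie_ofAlg,
        ih q hq (hX'.2 q hq y hy), map_smul, LinearMap.smul_apply]
      push_cast
      module

variable (𝓜) in
/-- The maximal prolongation. -/
def prolongation : LieSubalgebra K (formalFields K M) where
  toSubmodule := ⨆ p, prolong 𝓜 p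
  lie_mem' {X Y} hX hY := by
    refine Submodule.iSup_induction _ (motive := fun X => ⁅X, Y⁆ ∈ ⨆ p, prolong 𝓜 p) hX
      (fun p X hX => ?_) (by rw [zero_lie]; exact zero_mem _)
      (fun X X' h h' => by rw [add_lie]; exact add_mem h h')
    refine Submodule.iSup_induction _ (motive := fun Y => ⁅X, Y⁆ ∈ ⨆ p, prolong 𝓜 p) hY
      (fun q Y hY => ?_) (by rw [lie_zero]; exact zero_mem _)
      (fun Y Y' h h' => by rw [lie_add]; exact add_mem h h')
    exact Submodule.mem_iSup_of_mem _ (lie_mem_prolong hX hY)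

theorem prolong_le (p : ℤ) : prolong 𝓜 p ≤ (prolongation 𝓜).toSubmodule :=
  le_iSup (prolong 𝓜) p

variable (𝓜) in
/-- The grading of the maximal prolongation. -/
def prolongGrading (p : ℤ) : Submodule K (prolongation 𝓜) :=
  (prolong 𝓜 p).comap (prolongation 𝓜).toSubmodule.subtype

theorem mem_prolongGrading {p : ℤ} {X : prolongation 𝓜} :
    X ∈ prolongGrading 𝓜 p ↔ X.1 ∈ prolong 𝓜 p := Iff.rfl

theorem prolongGrading_iSup : ⨆ p, prolongGrading 𝓜 p = ⊤ := by
  refine eq_top_iff.2 fun ⟨X, hX⟩ _ => ?_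
  refine Submodule.iSup_induction' (prolong 𝓜)
    (motive := fun X hX => (⟨X, hX⟩ : prolongation 𝓜) ∈ ⨆ p, prolongGrading 𝓜 p)
    (fun p X h => Submodule.mem_iSup_of_mem p (mem_prolongGrading.2 h)) (zero_mem _)
    (fun X Y hX hY h h' => add_mem h h') hX

/-- The components lie in eigenspaces of the grading element, with eigenvalues that are distinct in
characteristic zero. -/
theorem prolongGrading_iSupIndep (h𝓜 : ∀ p, 0 ≤ p → 𝓜 p = ⊥) :
    iSupIndep (prolongGrading 𝓜) := by
  let E : prolongation 𝓜 := ⟨eulerField 𝓜, prolong_le 0 eulerField_mem⟩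
  refine ((Module.End.eigenspaces_iSupIndep (LieAlgebra.ad K _ E)).comp
    (f := fun p : ℤ => (p : K)) Int.cast_injective).mono fun p X hX => ?_
  exact Module.End.mem_eigenspace_iff.2 (Subtype.ext (eulerField_lie h𝓜 hX))

variable (𝓜) in
/-- The maximal prolongation is a graded Lie algebra. -/
abbrev gradedProlongation (h𝓜 : ∀ p, 0 ≤ p → 𝓜 p = ⊥) :
    GradedLieAlgebra (prolongGrading 𝓜) where
  bracket_mem _ _ _ _ hX hY := lie_mem_prolong (𝓜 := 𝓜) hX hY
  __ := (DirectSum.isInternal_submodule_of_iSupIndep_of_iSup_eq_top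
    (prolongGrading_iSupIndep h𝓜) prolongGrading_iSup).chooseDecomposition

end Prolongation

end ExtTranslation
end

noncomputable section

namespace ExtTranslation

/-! ### Maximality -/

section Maximality

open formalFields

variable {K M : Type*} [Field K] [LieRing M] [LieAlgebra K M]
  {𝓜 : ℤ → Submodule K M}

theorem finiteDimensional_of_bilinear {A B C : Type*} [AddCommGroup A] [AddCommGroup B]
    [AddCommGroup C] [Module K A] [Module K B] [Module K C] [FiniteDimensional K B]
    [FiniteDimensional K C] (f : A →ₗ[K] B →ₗ[K] C) (hf : ∀ a, (∀ b, f a b = 0) → a = 0) :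
    FiniteDimensional K A :=
  FiniteDimensional.of_injective f ((injective_iff_map_eq_zero f).2 fun a ha =>
    hf a fun b => by rw [ha, LinearMap.zero_apply])

theorem eq_bot_of_nonneg (h𝓜 : ∀ p, p ≠ -1 → p ≠ -2 → 𝓜 p = ⊥) (p : ℤ) (hp : 0 ≤ p) :
    𝓜 p = ⊥ := h𝓜 p (by omega) (by omega)

/-- The kernel of `π` is the sum of the components of nonnegative degree, hence a subalgebra. This
is the hypothesis of `ofHom_lie`. -/
theorem lie_projection_eq_zero {L : Type*} [LieRing L] [LieAlgebra K L]
    {𝓛 : ℤ → Submodule K L} [GradedLieAlgebra 𝓛] {j : M →ₗ⁅K⁆ L}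
    (h1 : (𝓜 (-1)).map (j : M →ₗ[K] L) = 𝓛 (-1)) (h2 : (𝓜 (-2)).map (j : M →ₗ[K] L) = 𝓛 (-2))
    (h3 : ∀ p < -2, 𝓛 p = ⊥) {π : L →ₗ[K] M} (hj : ∀ y, π (j y) = y)
    (hπ : ∀ p, 0 ≤ p → ∀ X ∈ 𝓛 p, π X = 0) (X Y : L) (hX : π X = 0) (hY : π Y = 0) :
    π ⁅X, Y⁆ = 0 := by
  let S : Submodule K L := ⨆ p : ℕ, 𝓛 p
  have hS : ∀ X, X - j (π X) ∈ S := by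
    intro X
    induction X using DirectSum.Decomposition.inductionOn 𝓛 with
    | zero => simp
    | @homogeneous q X =>
      obtain ⟨X, hX⟩ := X
      have hneg : ∀ y : M, j y = X → X - j (π X) ∈ S := by
        rintro y rfl
        simp [hj]
      rcases lt_or_ge q 0 with hq | hq
      · by_cases hq1 : q = -1
        · subst hq1
          obtain ⟨y, _, hy⟩ := h1 ▸ hX
          exact hneg y hy
        by_cases hq2 : q = -2
        · subst hq2
          obtain ⟨y, _, hy⟩ := h2 ▸ hX
          exact hneg y hy
        have : X = 0 := by simpa [h3 q (by omega)] using hX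
        simp [this]
      · rw [hπ q hq X hX, map_zero, sub_zero]
        lift q to ℕ using hq
        exact Submodule.mem_iSup_of_mem q hX
    | add X Y hX hY =>
      rw [map_add, map_add, add_sub_add_comm]
      exact add_mem hX hY
  have hXS := hS X
  have hYS := hS Y
  rw [hX, map_zero, sub_zero] at hXS
  rw [hY, map_zero, sub_zero] at hYS
  clear hX hY
  refine Submodule.iSup_induction _ (motive := fun X => π ⁅X, Y⁆ = 0) hXS
    (fun p X hX => ?_) (by simp) (fun X X' h h' => by rw [add_lie, map_add, h, h', add_zero])
  refine Submodule.iSup_induction _ (motive := fun Y => π ⁅X, Y⁆ = 0) hYS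
    (fun q Y hY => ?_) (by simp) (fun Y Y' h h' => by rw [lie_add, map_add, h, h', add_zero])
  exact hπ _ (by positivity) _ (SetLike.GradedBracket.bracket_mem hX hY)

theorem ofHom_mem_prolong (h𝓜 : ∀ p, p ≠ -1 → p ≠ -2 → 𝓜 p = ⊥)
    {L : Type*} [LieRing L] [LieAlgebra K L]
    {𝓛 : ℤ → Submodule K L} [GradedLieAlgebra 𝓛] {j : M →ₗ⁅K⁆ L}
    (h1 : (𝓜 (-1)).map (j : M →ₗ[K] L) = 𝓛 (-1)) (h2 : (𝓜 (-2)).map (j : M →ₗ[K] L) = 𝓛 (-2))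
    (h3 : ∀ p < -2, 𝓛 p = ⊥) {π : L →ₗ[K] M} (hj : ∀ y, π (j y) = y)
    (hπ : ∀ p, 0 ≤ p → ∀ X ∈ 𝓛 p, π X = 0) {p : ℤ} {X : L} (hX : X ∈ 𝓛 p) :
    ofHom j π X ∈ prolong 𝓜 p := by
  induction p using degree_induction generalizing X with
  | neg p hp =>
    have hneg : ∀ y ∈ 𝓜 p, j y = X → ofHom j π X ∈ prolong 𝓜 p := by
      rintro y hy rfl
      rw [ofHom_map j π hj]
      exact (mem_prolong_of_neg hp).2 ⟨y, hy, rfl⟩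
    by_cases hp1 : p = -1
    · subst hp1
      obtain ⟨y, hy, hyX⟩ := h1 ▸ hX
      exact hneg y hy hyX
    by_cases hp2 : p = -2
    · subst hp2
      obtain ⟨y, hy, hyX⟩ := h2 ▸ hX
      exact hneg y hy hyX
    have : X = 0 := by simpa [h3 p (by omega)] using hX
    rw [this, map_zero]
    exact zero_mem _
  | nonneg p hp ih =>
    refine (mem_prolong_of_nonneg hp).2 ⟨hπ p hp X hX, fun q hq y hy => ?_⟩
    rw [shift_ofHom]
    refine ih q hq (SetLike.GradedBracket.bracket_mem hX ?_)
    by_cases hq1 : q = -1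
    · subst hq1
      exact h1 ▸ Submodule.mem_map_of_mem hy
    by_cases hq2 : q = -2
    · subst hq2
      exact h2 ▸ Submodule.mem_map_of_mem hy
    have : y = 0 := by simpa [h𝓜 q hq1 hq2] using hy
    rw [this, map_zero]
    exact zero_mem _

/-- Elements of a transitive prolongation are determined by their formal vector fields. -/
theorem eq_zero_of_ofHom_eq_zero
    {L : Type*} [LieRing L] [LieAlgebra K L]
    {𝓛 : ℤ → Submodule K L} [GradedLieAlgebra 𝓛] {j : M →ₗ⁅K⁆ L}
    (h1 : (𝓜 (-1)).map (j : M →ₗ[K] L) = 𝓛 (-1)) (h2 : (𝓜 (-2)).map (j : M →ₗ[K] L) = 𝓛 (-2))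
    (h3 : ∀ p < -2, 𝓛 p = ⊥)
    (htr : ∀ p : ℤ, 0 ≤ p → ∀ X ∈ 𝓛 p, (∀ w ∈ 𝓛 (-1), ⁅X, w⁆ = 0) → X = 0)
    {π : L →ₗ[K] M} (hj : ∀ y, π (j y) = y) {p : ℤ} {X : L} (hX : X ∈ 𝓛 p)
    (h : ofHom j π X = 0) : X = 0 := by
  induction p using degree_induction generalizing X with
  | neg p hp =>
    have hneg : ∀ y, j y = X → X = 0 := by
      rintro y rfl
      rw [ofHom_map j π hj] at h
      rw [ofAlg_injective (h.trans (map_zero _).symm), map_zero]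
    by_cases hp1 : p = -1
    · subst hp1
      obtain ⟨y, _, hy⟩ := h1 ▸ hX
      exact hneg y hy
    by_cases hp2 : p = -2
    · subst hp2
      obtain ⟨y, _, hy⟩ := h2 ▸ hX
      exact hneg y hy
    simpa [h3 p (by omega)] using hX
  | nonneg p hp ih =>
    refine htr p hp X hX fun w hw => ?_
    obtain ⟨y, _, hy⟩ := h1.symm ▸ hw
    refine ih (-1) (by norm_num) (SetLike.GradedBracket.bracket_mem hX hw) ?_
    rw [← hy]
    change ofHom j π ⁅X, j y⁆ = 0
    rw [← shift_ofHom, h, map_zero, LinearMap.zero_apply]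

variable [GradedLieAlgebra 𝓜]

/-- Derivatives along 𝔪₋₂ are commutators of derivatives along 𝔪₋₁, so all of them vanish; so does
the value at the origin. -/
theorem prolong_transitive (h𝓜 : ∀ p, p ≠ -1 → p ≠ -2 → 𝓜 p = ⊥)
    (hgen : 𝓜 (-2) ≤ Submodule.span K {z | ∃ x ∈ 𝓜 (-1), ∃ y ∈ 𝓜 (-1), ⁅x, y⁆ = z})
    {p : ℤ} (hp : 0 ≤ p) {X : formalFields K M} (hX : X ∈ prolong 𝓜 p)
    (h : ∀ y ∈ 𝓜 (-1), shift X y = 0) : X = 0 := by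
  refine ext_shift ((mem_prolong_of_nonneg hp).1 hX).1
    (linearMap_ext_of_neg (eq_bot_of_nonneg h𝓜) fun q _ y hy => ?_)
  by_cases h1 : q = -1
  · subst h1
    simpa using h y hy
  by_cases h2 : q = -2
  · subst h2
    have hle : Submodule.span K {z | ∃ x ∈ 𝓜 (-1), ∃ y ∈ 𝓜 (-1), ⁅x, y⁆ = z} ≤
        LinearMap.ker (shift X) := by
      refine Submodule.span_le.2 ?_
      rintro _ ⟨x, hx, y, hy, rfl⟩
      simp [shift_lie, h x hx, h y hy]
    simpa using hle (hgen hy)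
  · have : y = 0 := by simpa [h𝓜 q h1 h2] using hy
    simp [this]

/-- By transitivity the component of degree p ≥ 0 embeds into the linear maps from 𝔪₋₁ to the
component of degree p − 1. -/
theorem prolong_finite (h𝓜 : ∀ p, p ≠ -1 → p ≠ -2 → 𝓜 p = ⊥)
    (hgen : 𝓜 (-2) ≤ Submodule.span K {z | ∃ x ∈ 𝓜 (-1), ∃ y ∈ 𝓜 (-1), ⁅x, y⁆ = z})
    (hfin : ∀ p, FiniteDimensional K (𝓜 p)) (p : ℤ) : FiniteDimensional K (prolong 𝓜 p) := by
  induction p using degree_induction with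
  | neg p hp =>
    have : prolong 𝓜 p = (𝓜 p).map ofAlg := by
      ext X
      simp [mem_prolong_of_neg hp]
    rw [this]
    have := hfin p
    infer_instance
  | nonneg p hp ih =>
    have := ih (-1) (by norm_num)
    have := hfin (-1)
    let f : prolong 𝓜 p →ₗ[K] 𝓜 (-1) →ₗ[K] prolong 𝓜 (p + -1) :=
      LinearMap.mk₂ K (fun X y => ⟨shift X.1 y.1, shift_mem_prolong (by norm_num) X.2 y.2⟩)
        (fun X Y y => Subtype.ext (by simp)) (fun c X y => Subtype.ext (by simp))
        (fun X y z => Subtype.ext (by simp)) (fun c X y => Subtype.ext (by simp))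
    refine finiteDimensional_of_bilinear (A := prolong 𝓜 p) (B := 𝓜 (-1))
      (C := prolong 𝓜 (p + -1)) f fun X hX => ?_
    refine Subtype.ext (prolong_transitive h𝓜 hgen hp X.2 fun y hy => ?_)
    exact congrArg Subtype.val (hX ⟨y, hy⟩)

/-- A projection of a transitive prolongation to its negative part. -/
theorem exists_projection {L : Type*} [LieRing L] [LieAlgebra K L]
    {𝓛 : ℤ → Submodule K L} [GradedLieAlgebra 𝓛] (j : M →ₗ⁅K⁆ L) (hinj : Function.Injective j)
    (h𝓜 : ∀ p, p ≠ -1 → p ≠ -2 → 𝓜 p = ⊥)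
    (h1 : (𝓜 (-1)).map (j : M →ₗ[K] L) = 𝓛 (-1)) (h2 : (𝓜 (-2)).map (j : M →ₗ[K] L) = 𝓛 (-2)) :
    ∃ π : L →ₗ[K] M, (∀ y, π (j y) = y) ∧ (∀ p, 0 ≤ p → ∀ X ∈ 𝓛 p, π X = 0) := by
  obtain ⟨g, hg⟩ := LinearMap.exists_leftInverse_of_injective (j : M →ₗ[K] L)
    (LinearMap.ker_eq_bot.2 hinj)
  let c : ℤ → L →ₗ[K] L := fun p =>
    (𝓛 p).subtype ∘ₗ DirectSum.component K ℤ (fun p => 𝓛 p) p ∘ₗ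
      (DirectSum.decomposeLinearEquiv 𝓛).toLinearMap
  have hc : ∀ p q, ∀ X ∈ 𝓛 q, c p X = if q = p then X else 0 := by
    intro p q X hX
    split_ifs with h
    · subst h
      exact DirectSum.decompose_of_mem_same 𝓛 hX
    · exact DirectSum.decompose_of_mem_ne 𝓛 hX h
  -- A left inverse `g` of `j` need not kill nonnegative degrees, so the element is first cut down
  -- to degrees −1 and −2.
  refine ⟨g ∘ₗ (c (-1) + c (-2)), fun y => ?_, fun p hp X hX => ?_⟩
  · have key : (c (-1) + c (-2)) (j y) = j y := by
      induction y using DirectSum.Decomposition.inductionOn 𝓜 with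
      | zero => simp
      | @homogeneous q y =>
        by_cases hq1 : q = -1
        · subst hq1
          have : j y ∈ 𝓛 (-1) := h1 ▸ Submodule.mem_map_of_mem y.2
          simp [hc _ _ _ this]
        by_cases hq2 : q = -2
        · subst hq2
          have : j y ∈ 𝓛 (-2) := h2 ▸ Submodule.mem_map_of_mem y.2
          simp [hc _ _ _ this]
        have : (y : M) = 0 := by simpa [h𝓜 q hq1 hq2] using y.2
        simp [this]
      | add x y hx hy => rw [map_add, map_add, hx, hy]
    rw [LinearMap.comp_apply, key]
    exact LinearMap.congr_fun hg y
  · rw [LinearMap.comp_apply, LinearMap.add_apply, hc _ _ _ hX, hc _ _ _ hX,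
      if_neg (by omega), if_neg (by omega), add_zero, map_zero]

theorem decompose_map {L L' : Type*} [AddCommGroup L] [Module K L] [AddCommGroup L'] [Module K L']
    (𝓛 : ℤ → Submodule K L) [DirectSum.Decomposition 𝓛] (𝓛' : ℤ → Submodule K L')
    [DirectSum.Decomposition 𝓛'] (φ : L →ₗ[K] L') (hφ : ∀ p, ∀ X ∈ 𝓛 p, φ X ∈ 𝓛' p) (X : L) (p : ℤ) :
    (DirectSum.decompose 𝓛' (φ X) p : L') = φ (DirectSum.decompose 𝓛 X p) := by
  induction X using DirectSum.Decomposition.inductionOn 𝓛 with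
  | zero => simp
  | @homogeneous q X =>
    by_cases h : q = p
    · subst h
      rw [DirectSum.decompose_of_mem_same 𝓛' (hφ q X X.2), DirectSum.decompose_of_mem_same 𝓛 X.2]
    · rw [DirectSum.decompose_of_mem_ne 𝓛' (hφ q X X.2) h, DirectSum.decompose_of_mem_ne 𝓛 X.2 h,
        map_zero]
  | add X Y hX hY =>
    simp only [map_add, DirectSum.decompose_add, DirectSum.add_apply, Submodule.coe_add, hX, hY]

variable [CharZero K]

theorem prolongation_isTransitive (h𝓜 : ∀ p, p ≠ -1 → p ≠ -2 → 𝓜 p = ⊥)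
    (hgen : 𝓜 (-2) ≤ Submodule.span K {z | ∃ x ∈ 𝓜 (-1), ∃ y ∈ 𝓜 (-1), ⁅x, y⁆ = z})
    (hfin : ∀ p, FiniteDimensional K (𝓜 p)) :
    letI := gradedProlongation 𝓜 (eq_bot_of_nonneg h𝓜)
    IsTransitiveProlongation 𝓜 (prolongGrading 𝓜) := by
  let := gradedProlongation 𝓜 (eq_bot_of_nonneg h𝓜)
  have hmem : ∀ y : M, (ofAlg y : formalFields K M) ∈ (prolongation 𝓜).toSubmodule := by
    intro y
    induction y using DirectSum.Decomposition.inductionOn 𝓜 with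
    | zero => rw [map_zero]; exact zero_mem _
    | @homogeneous q y =>
      rcases lt_or_ge q 0 with hq | hq
      · exact prolong_le q ((mem_prolong_of_neg hq).2 ⟨y, y.2, rfl⟩)
      · have : (y : M) = 0 := by simpa [eq_bot_of_nonneg h𝓜 q hq] using y.2
        rw [this, map_zero]; exact zero_mem _
    | add x y hx hy => rw [map_add]; exact add_mem hx hy
  let j : M →ₗ⁅K⁆ prolongation 𝓜 :=
    { toFun := fun y => ⟨ofAlg y, hmem y⟩
      map_add' := fun x y => Subtype.ext (map_add _ x y)
      map_smul' := fun c x => Subtype.ext (map_smul _ c x)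
      map_lie' := fun {x y} => Subtype.ext ((ofAlgHom K M).map_lie x y) }
  have hj : ∀ p < 0, (𝓜 p).map (j : M →ₗ[K] prolongation 𝓜) = prolongGrading 𝓜 p := by
    intro p hp
    ext X
    rw [mem_prolongGrading, mem_prolong_of_neg hp, Submodule.mem_map]
    exact exists_congr fun y => and_congr_right fun _ => Subtype.ext_iff
  refine ⟨fun p => ?_, ⟨j, fun x y h => ofAlg_injective (congrArg Subtype.val h),
    hj _ (by norm_num), hj _ (by norm_num)⟩, fun p hp => ?_, fun p hp X hX h => ?_⟩
  · have := prolong_finite h𝓜 hgen hfin p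
    exact FiniteDimensional.of_injective
      ((prolongation 𝓜).toSubmodule.subtype.restrict (p := prolongGrading 𝓜 p)
        (q := prolong 𝓜 p) fun _ h => h)
      fun x y h => Subtype.ext (Subtype.ext (congrArg (fun Z : prolong 𝓜 p => Z.1) h))
  · rw [← hj p (by omega), h𝓜 p (by omega) (by omega), Submodule.map_bot]
  · refine Subtype.ext (prolong_transitive h𝓜 hgen hp hX fun y hy => ?_)
    rw [← lie_ofAlg]
    exact congrArg Subtype.val (h (j y) ((mem_prolong_of_neg (by norm_num)).2 ⟨y, hy, rfl⟩))

theorem prolongation_isMaximal {K : Type u} {M : Type v} [Field K] [CharZero K] [LieRing M]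
    [LieAlgebra K M] {𝓜 : ℤ → Submodule K M} [GradedLieAlgebra 𝓜]
    (h𝓜 : ∀ p, p ≠ -1 → p ≠ -2 → 𝓜 p = ⊥)
    (hgen : 𝓜 (-2) ≤ Submodule.span K {z | ∃ x ∈ 𝓜 (-1), ∃ y ∈ 𝓜 (-1), ⁅x, y⁆ = z})
    (hfin : ∀ p, FiniteDimensional K (𝓜 p)) :
    letI := gradedProlongation 𝓜 (eq_bot_of_nonneg h𝓜)
    IsMaximalTransitiveProlongation 𝓜 (prolongGrading 𝓜) := by
  let := gradedProlongation 𝓜 (eq_bot_of_nonneg h𝓜)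
  refine ⟨prolongation_isTransitive h𝓜 hgen hfin, fun L _ _ 𝓛 _ hL => ?_⟩
  obtain ⟨j, hinj, h1, h2⟩ := hL.negative
  have h3 := hL.depth
  obtain ⟨π, hj, hπ⟩ := exists_projection j hinj h𝓜 h1 h2
  have hhom : ∀ {p X}, X ∈ 𝓛 p → ofHom j π X ∈ prolong 𝓜 p := fun hX =>
    ofHom_mem_prolong h𝓜 h1 h2 h3 hj hπ hX
  have hmem : ∀ X, ofHom j π X ∈ (prolongation 𝓜).toSubmodule := by
    intro X
    induction X using DirectSum.Decomposition.inductionOn 𝓛 with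
    | zero => rw [map_zero]; exact zero_mem _
    | homogeneous X => exact prolong_le _ (hhom X.2)
    | add X Y hX hY => rw [map_add]; exact add_mem hX hY
  let φ : L →ₗ⁅K⁆ prolongation 𝓜 :=
    { toFun := fun X => ⟨ofHom j π X, hmem X⟩
      map_add' := fun x y => Subtype.ext (map_add _ x y)
      map_smul' := fun c x => Subtype.ext (map_smul _ c x)
      map_lie' := fun {x y} =>
        Subtype.ext (ofHom_lie j π hj (lie_projection_eq_zero h1 h2 h3 hj hπ) x y) }
  refine ⟨φ, (injective_iff_map_eq_zero φ).2 fun X hX => ?_, fun p X hX => hhom hX⟩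
  -- A graded map that kills X kills its homogeneous components, and on those transitivity applies.
  have hcomp : ∀ p, (DirectSum.decompose 𝓛 X p : L) = 0 := by
    intro p
    refine eq_zero_of_ofHom_eq_zero h1 h2 h3 hL.transitive hj (DirectSum.decompose 𝓛 X p).2
      (congrArg Subtype.val (?_ : φ (DirectSum.decompose 𝓛 X p) = 0))
    have := decompose_map 𝓛 (prolongGrading 𝓜) (φ : L →ₗ[K] prolongation 𝓜)
      (fun p X hX => hhom hX) X p
    rw [show (φ : L →ₗ[K] prolongation 𝓜) X = 0 from hX, DirectSum.decompose_zero] at this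
    exact this.symm
  rw [← (DirectSum.decompose 𝓛).symm_apply_apply X, show DirectSum.decompose 𝓛 X = 0 from
    DFinsupp.ext fun p => Subtype.ext (hcomp p), DirectSum.decompose_symm_zero]

end Maximality

end ExtTranslation
end

noncomputable section

namespace ExtTranslation

/-! ### Linear algebra of Clifford modules with an admissible form -/

section Clifford

variable {K V W : Type*} [RCLike K] [AddCommGroup V] [Module K V]
  [AddCommGroup W] [Module K W]

/-- The isomorphism W ≅ W* given by `B` conjugates `f` into the transpose of `g`. -/
theorem trace_eq_of_isAdjointPair [FiniteDimensional K W] {B : LinearMap.BilinForm K W}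
    (hB : B.Nondegenerate) {f g : Module.End K W} (h : ∀ x y, B (f x) y = B x (g y)) :
    LinearMap.trace K W f = LinearMap.trace K W g := by
  rw [← LinearMap.trace_transpose' g, ← LinearMap.trace_conj' f (B.toDual hB)]
  congr 1
  ext x y
  obtain ⟨x, rfl⟩ := (B.toDual hB).surjective x
  simp [LinearEquiv.conj_apply, LinearMap.BilinForm.toDual_def, h, Module.Dual.transpose_apply]

namespace Datum

variable (D : Datum K V W)

theorem cl_mul_self (v : V) : D.cl v * D.cl v = -(D.form v v) • (1 : Module.End K W) := by
  have h := congrArg D.act (CliffordAlgebra.ι_sq_scalar (-D.form.toQuadraticMap) v)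
  rw [map_mul, AlgHom.commutes, Algebra.algebraMap_eq_smul_one] at h
  exact h

theorem cl_mul_add_swap (u v : V) :
    D.cl u * D.cl v + D.cl v * D.cl u = (-2 * D.form u v) • (1 : Module.End K W) := by
  have h := D.cl_mul_self (u + v)
  have hu := D.cl_mul_self u
  have hv := D.cl_mul_self v
  simp only [map_add, add_mul, mul_add, LinearMap.add_apply, hu, hv, D.form_symm v u] at h
  have e : D.cl u * D.cl v + D.cl v * D.cl u =
      -(D.form u u) • (1 : Module.End K W) + D.cl v * D.cl u + (D.cl u * D.cl v +
        -(D.form v v) • (1 : Module.End K W)) + (D.form u u + D.form v v) •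
          (1 : Module.End K W) := by
    module
  rw [e]
  rw [h]
  module

theorem cl_mul_swap {u v : V} (h : D.form u v = 0) : D.cl v * D.cl u = -(D.cl u * D.cl v) := by
  have := D.cl_mul_add_swap u v
  rw [h, mul_zero, zero_smul] at this
  exact eq_neg_of_add_eq_zero_right this

theorem eq_zero_of_cl_mul {u : V} (hu : D.form u u ≠ 0) {f : Module.End K W}
    (h : D.cl u * f = 0) : f = 0 := by
  have : D.cl u * (D.cl u * f) = 0 := by rw [h, mul_zero]
  rw [← mul_assoc, cl_mul_self, smul_mul_assoc, one_mul] at this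
  exact (smul_eq_zero.1 this).resolve_left (neg_ne_zero.2 hu)

theorem eps_mul_self : D.eps * D.eps = 1 := by
  rcases D.beta_symm_or_skew with ⟨h, -⟩ | ⟨h, -⟩ <;> simp [h]

theorem beta_cl (v : V) (s t : W) : D.beta (D.cl v s) t = D.eps * D.beta s (D.cl v t) :=
  D.beta_clifford v s t

theorem beta_cl_cl (u v : V) (s t : W) :
    D.beta (D.cl u (D.cl v s)) t = D.beta s (D.cl v (D.cl u t)) := by
  rw [beta_cl, beta_cl, ← mul_assoc, eps_mul_self, one_mul]

theorem eq_zero_of_beta {s : W} (h : ∀ t, D.beta s t = 0) : s = 0 :=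
  D.beta_nondegenerate.1 s h

theorem end_eq_of_beta {f g : Module.End K W} (h : ∀ s t, D.beta (f s) t = D.beta (g s) t) :
    f = g :=
  LinearMap.ext fun s => sub_eq_zero.1 <| D.eq_zero_of_beta fun t => by
    rw [map_sub, LinearMap.sub_apply, h, sub_self]

/-- This is where dim V ≥ 3 enters. The vectors are non-isotropic, so each acts invertibly on W. -/
theorem exists_orthogonal_triple [FiniteDimensional K V] (hV : 3 ≤ Module.finrank K V) :
    ∃ e : Fin 3 → V, (∀ i, D.form (e i) (e i) ≠ 0) ∧ ∀ i j, i ≠ j → D.form (e i) (e j) = 0 := by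
  have : Invertible (2 : K) := invertibleOfNonzero two_ne_zero
  obtain ⟨b, hb⟩ := LinearMap.BilinForm.exists_orthogonal_basis (B := D.form) ⟨D.form_symm⟩
  exact ⟨fun i => b (Fin.castLE hV i),
    fun i => hb.not_isOrtho_basis_self_of_separatingLeft D.form_nondegenerate.1 _,
    fun i j hij => hb fun h => hij (Fin.castLE_injective hV h)⟩

/-- The first prolongation of the commutant of the even Clifford algebra vanishes. -/
theorem first_prolongation_eq_zero {e : Fin 3 → V} (he : ∀ i, D.form (e i) (e i) ≠ 0)
    (heo : ∀ i j, i ≠ j → D.form (e i) (e j) = 0) {Φ : W → Module.End K W}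
    (hΦ : ∀ s t, Φ s t = Φ t s)
    (hc : ∀ s u v, D.form u u ≠ 0 → Φ s * (D.cl u * D.cl v) = D.cl u * D.cl v * Φ s) (s t : W) :
    Φ s t = 0 := by
  have hc' : ∀ i j s t, Φ s ((D.cl (e i) * D.cl (e j)) t) = (D.cl (e i) * D.cl (e j)) (Φ s t) :=
    fun i j s t => LinearMap.congr_fun (hc s (e i) (e j) (he i)) t
  let a := D.cl (e 0) * D.cl (e 1)
  let b := D.cl (e 1) * D.cl (e 2)
  -- Extracting `a` and `b` from the two arguments in either order gives the same element, although
  -- `a` and `b` anticommute.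
  have h1 : Φ (a s) (b t) = b (a (Φ s t)) := by rw [hc', hΦ, hc', hΦ t s]
  have h2 : Φ (a s) (b t) = a (b (Φ s t)) := by rw [hΦ, hc', hΦ, hc']
  have hab : a * b = -(D.form (e 1) (e 1)) • (D.cl (e 0) * D.cl (e 2)) := by
    simp only [a, b]
    rw [mul_assoc, ← mul_assoc (D.cl (e 1)), cl_mul_self, smul_mul_assoc, one_mul, mul_smul_comm]
  have hba : b * a = D.form (e 1) (e 1) • (D.cl (e 0) * D.cl (e 2)) := by
    simp only [a, b]
    rw [D.cl_mul_swap (heo 1 0 (by decide)), mul_neg, mul_assoc, ← mul_assoc (D.cl (e 2)),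
      D.cl_mul_swap (heo 1 2 (by decide)), neg_mul, mul_neg, neg_neg, mul_assoc (D.cl (e 1)),
      ← mul_assoc (D.cl (e 1)), cl_mul_self, smul_mul_assoc, one_mul,
      D.cl_mul_swap (heo 0 2 (by decide)), smul_neg, neg_smul, neg_neg]
  have h3 : (2 * D.form (e 1) (e 1)) • D.cl (e 0) (D.cl (e 2) (Φ s t)) = 0 := by
    have : (b * a) (Φ s t) = (a * b) (Φ s t) := h1.symm.trans h2
    rw [hab, hba, LinearMap.smul_apply, LinearMap.smul_apply, Module.End.mul_apply, neg_smul, eq_neg_iff_add_eq_zero, ← add_smul,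
      ← two_mul] at this
    exact this
  have hinj : ∀ i x, D.cl (e i) x = 0 → x = 0 := by
    intro i x hx
    have := LinearMap.congr_fun (D.cl_mul_self (e i)) x
    rw [Module.End.mul_apply, hx, map_zero, LinearMap.smul_apply, Module.End.one_apply] at this
    exact (smul_eq_zero.1 this.symm).resolve_left (neg_ne_zero.2 (he i))
  exact hinj 2 _ (hinj 0 _ ((smul_eq_zero.1 h3).resolve_left (mul_ne_zero two_ne_zero (he 1))))

/-- The relation at u = v = eᵢ says 2eᵢH(eᵢ) = (eᵢ, eᵢ)Λ. As e₀ anticommutes with e₀e₁ while e₂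
commutes with it, Λ does both with the invertible e₀e₁, so Λ = 0. Then H(e₀) = 0, and the relation
for e₀ and v gives H(v) = 0. -/
theorem eq_zero_of_cl_mul_add {e : Fin 3 → V} (he : ∀ i, D.form (e i) (e i) ≠ 0)
    (heo : ∀ i j, i ≠ j → D.form (e i) (e j) = 0) {H : V → Module.End K W} {Λ : Module.End K W}
    (hΛ : ∀ u v, D.cl u * H v + D.cl v * H u = D.form u v • Λ)
    (hc : ∀ x u v, D.form u u ≠ 0 → H x * (D.cl u * D.cl v) = D.cl u * D.cl v * H x) (v : V) :
    H v = 0 := by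
  set E : Fin 3 → Module.End K W := fun i => D.cl (e i) with hE
  have hΛ' : ∀ i, (2 : K) • (E i * H (e i)) = D.form (e i) (e i) • Λ := fun i => by
    rw [two_smul, ← hΛ]
  have hc' : ∀ i, H (e i) * (E 0 * E 1) = E 0 * E 1 * H (e i) := fun i => hc _ _ _ (he 0)
  have h01 : E 1 * E 0 = -(E 0 * E 1) := D.cl_mul_swap (heo 0 1 (by decide))
  have h02 : E 2 * E 0 = -(E 0 * E 2) := D.cl_mul_swap (heo 0 2 (by decide))
  have h12 : E 2 * E 1 = -(E 1 * E 2) := D.cl_mul_swap (heo 1 2 (by decide))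
  have hE0 : E 0 * (E 0 * E 1) = -(E 0 * E 1 * E 0) := by
    rw [mul_assoc, h01, mul_neg, neg_neg]
  have hE2 : E 2 * (E 0 * E 1) = E 0 * E 1 * E 2 := by
    rw [← mul_assoc, h02, neg_mul, mul_assoc, h12, mul_neg, neg_neg, mul_assoc]
  have h0 : Λ * (E 0 * E 1) = -(E 0 * E 1 * Λ) := by
    refine smul_right_injective _ (he 0) ?_
    change D.form (e 0) (e 0) • (Λ * (E 0 * E 1)) = D.form (e 0) (e 0) • -(E 0 * E 1 * Λ)
    rw [← smul_mul_assoc, smul_neg, ← mul_smul_comm, ← hΛ', smul_mul_assoc, mul_assoc, hc',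
      ← mul_assoc, hE0, mul_smul_comm, neg_mul, smul_neg, mul_assoc _ (E 0)]
  have h2 : Λ * (E 0 * E 1) = E 0 * E 1 * Λ := by
    refine smul_right_injective _ (he 2) ?_
    change D.form (e 2) (e 2) • (Λ * (E 0 * E 1)) = D.form (e 2) (e 2) • (E 0 * E 1 * Λ)
    rw [← smul_mul_assoc, ← mul_smul_comm, ← hΛ', smul_mul_assoc, mul_assoc, hc',
      ← mul_assoc, hE2, mul_smul_comm, mul_assoc _ (E 2)]
  have hΛ0 : Λ = 0 := by
    have : (2 : K) • (E 0 * E 1 * Λ) = 0 := by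
      rw [two_smul]
      nth_rw 1 [← h2]
      rw [h0, neg_add_cancel]
    have := (smul_eq_zero.1 this).resolve_left two_ne_zero
    rw [mul_assoc] at this
    exact D.eq_zero_of_cl_mul (he 1) (D.eq_zero_of_cl_mul (he 0) this)
  have hH0 : H (e 0) = 0 := by
    have := hΛ' 0
    rw [hΛ0, smul_zero] at this
    exact D.eq_zero_of_cl_mul (he 0) ((smul_eq_zero.1 this).resolve_left two_ne_zero)
  have := hΛ (e 0) v
  rw [hΛ0, smul_zero, hH0, mul_zero, add_zero] at this
  exact D.eq_zero_of_cl_mul (he 0) this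

/-- The second prolongation of the conformal algebra vanishes. -/
theorem second_prolongation_eq_zero {e : Fin 3 → V} (he : ∀ i, D.form (e i) (e i) ≠ 0)
    (heo : ∀ i j, i ≠ j → D.form (e i) (e j) = 0) {T : V → V → V → V}
    (h12 : ∀ u v w, T u v w = T v u w) (h23 : ∀ u v w, T u v w = T u w v)
    (hc : ∀ u v, ∃ c, ∀ w z, D.form (T u v w) z + D.form w (T u v z) = c * D.form w z)
    (u v w : V) : T u v w = 0 := by
  choose c hc using hc
  let F : V → V → V → V → K := fun u v w z => D.form (T u v w) z
  have F12 : ∀ u v w z, F u v w z = F v u w z := fun u v w z => by simp only [F, h12 u v]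
  have F23 : ∀ u v w z, F u v w z = F u w v z := fun u v w z => by simp only [F, h23 u v]
  have hF : ∀ u v w z, F u v w z + F u v z w = c u v * D.form w z := fun u v w z => by
    rw [← hc]; simp only [F, D.form_symm w]
  have hfs := D.form_symm
  have c_symm : ∀ u v, c u v = c v u := by
    intro u v
    refine mul_right_cancel₀ (he 0) ?_
    rw [← hF, ← hF, F12 u v]
  -- The Koszul trick: F is symmetric in its first three arguments, and its symmetrisation in the
  -- last two is known, which determines F by c.
  have koszul : ∀ u v w z, 2 * F u v w z =
      c u v * D.form w z + c u w * D.form v z - c u z * D.form v w := by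
    intro u v w z
    linear_combination hF u v w z + hF u w v z - hF u z v w + F23 u v w z - F23 u v z w
      - F23 u w z v
  -- Symmetry of F in u, v becomes a condition on c alone; testing it on the orthogonal triple
  -- forces c = 0.
  have star : ∀ u v w z, c u w * D.form v z + c v z * D.form u w =
      c v w * D.form u z + c u z * D.form v w := by
    intro u v w z
    linear_combination koszul v u w z - koszul u v w z + 2 * F12 u v w z +
      c_symm v u * D.form w z
  have diag : ∀ i j, i ≠ j → c (e i) (e i) * D.form (e j) (e j) +
      c (e j) (e j) * D.form (e i) (e i) = 0 := by
    intro i j hij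
    rw [star (e i) (e j) (e i) (e j), heo i j hij, heo j i hij.symm]
    ring
  have h00 : c (e 0) (e 0) = 0 := by
    have h1 := diag 0 1 (by decide)
    have h2 := diag 0 2 (by decide)
    have h3 := diag 1 2 (by decide)
    have : c (e 0) (e 0) * (2 * D.form (e 1) (e 1) * D.form (e 2) (e 2)) = 0 := by
      linear_combination D.form (e 2) (e 2) * h1 + D.form (e 1) (e 1) * h2 -
        D.form (e 0) (e 0) * h3
    exact (mul_eq_zero.1 this).resolve_right
      (mul_ne_zero (mul_ne_zero two_ne_zero (he 1)) (he 2))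
  have h11 : c (e 1) (e 1) = 0 := by
    have h1 := diag 0 1 (by decide)
    rw [h00, zero_mul, zero_add] at h1
    exact (mul_eq_zero.1 h1).resolve_right (he 0)
  have h01 : c (e 0) (e 1) = 0 := by
    have := star (e 0) (e 2) (e 1) (e 2)
    rw [heo 0 1 (by decide), heo 0 2 (by decide), heo 2 1 (by decide)] at this
    simp only [mul_zero, add_zero] at this
    exact (mul_eq_zero.1 this).resolve_right (he 2)
  have hu0 : ∀ u, c u (e 0) = 0 := by
    intro u
    have := star u (e 1) (e 0) (e 1)
    rw [h11, heo 1 0 (by decide), c_symm (e 1), h01] at this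
    simp only [mul_zero, zero_mul, add_zero] at this
    exact (mul_eq_zero.1 this).resolve_right (he 1)
  have hc0 : ∀ u w, c u w = 0 := by
    intro u w
    have := star u (e 0) w (e 0)
    rw [h00, c_symm (e 0), hu0, hu0] at this
    simp only [zero_mul, add_zero] at this
    exact (mul_eq_zero.1 this).resolve_right (he 0)
  refine D.form_nondegenerate.1 _ fun z => ?_
  have := koszul u v w z
  simp only [hc0, zero_mul, add_zero, sub_zero] at this
  exact (mul_eq_zero.1 this).resolve_left two_ne_zero

section Adjoint

variable [FiniteDimensional K W]

/-- The adjoint with respect to `β`. -/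
def adj (f : Module.End K W) : Module.End K W :=
  D.beta.leftAdjointOfNondegenerate D.beta_nondegenerate f

theorem beta_adj (f : Module.End K W) (s t : W) : D.beta (D.adj f s) t = D.beta s (f t) :=
  LinearMap.BilinForm.isAdjointPairLeftAdjointOfNondegenerate D.beta D.beta_nondegenerate f s t

theorem trace_cl_mul_cl (u v : V) :
    LinearMap.trace K W (D.cl u * D.cl v) = -D.form u v * Module.finrank K W := by
  have h := congrArg (LinearMap.trace K W) (D.cl_mul_add_swap u v)
  rw [map_add, LinearMap.trace_mul_comm K (D.cl v), map_smul, LinearMap.trace_one,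
    smul_eq_mul] at h
  linear_combination h / 2

end Adjoint

variable [FiniteDimensional K V]

theorem form_br_right (s t : W) (v : V) : D.form v (D.br s t) = D.beta (D.cl v s) t := by
  rw [D.form_symm, D.form_br]

/-- `V` is spanned by brackets of elements of `W`. -/
theorem span_br [Nontrivial W] : Submodule.span K {x : V | ∃ s t, D.br s t = x} = ⊤ := by
  by_contra hne
  obtain ⟨f, hf, hle⟩ := Submodule.exists_le_ker_of_lt_top _ (lt_top_iff_ne_top.2 hne)
  obtain ⟨v, rfl⟩ := (D.form.toDual D.form_nondegenerate).surjective f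
  -- A functional (v, ·) that kills all brackets has β(v · s, t) = 0, so v acts by zero; as W ≠ 0,
  -- the Clifford relation then forces v = 0.
  have hv : D.cl v = 0 := D.end_eq_of_beta fun s t => by
    have : D.br s t ∈ LinearMap.ker (D.form.toDual D.form_nondegenerate v) :=
      hle (Submodule.subset_span ⟨s, t, rfl⟩)
    rw [LinearMap.mem_ker, LinearMap.BilinForm.toDual_def, form_br_right] at this
    rw [this, LinearMap.zero_apply, map_zero, LinearMap.zero_apply]
  refine hf ?_
  have : v = 0 := D.form_nondegenerate.1 v fun u => by
    have h := D.cl_mul_add_swap v u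
    rw [hv, zero_mul, mul_zero, add_zero] at h
    have := (smul_eq_zero.1 h.symm).resolve_right one_ne_zero
    exact (mul_eq_zero.1 this).resolve_left (by norm_num)
  rw [this, map_zero]

variable [FiniteDimensional K W]

/-- A derivation of degree zero acts on `V` by conformal endomorphisms. -/
theorem exists_conformal [Nontrivial W] {ρ : Module.End K W} {σ : Module.End K V}
    (h : ∀ s t, σ (D.br s t) = D.br (ρ s) t + D.br s (ρ t)) :
    ∃ c, ∀ u v, D.form (σ u) v + D.form u (σ v) = c * D.form u v := by
  have hN : (Module.finrank K W : K) ≠ 0 := Nat.cast_ne_zero.2 Module.finrank_pos.ne'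
  let σ' := D.form.leftAdjointOfNondegenerate D.form_nondegenerate σ
  have hσ' : ∀ u v, D.form (σ' u) v = D.form u (σ v) :=
    LinearMap.BilinForm.isAdjointPairLeftAdjointOfNondegenerate D.form D.form_nondegenerate σ
  -- The derivation rule paired with v, rewritten with adjoints for both forms.
  have key : ∀ v, D.cl (σ' v) = D.cl v * ρ + D.adj ρ * D.cl v := by
    refine fun v => D.end_eq_of_beta fun s t => ?_
    rw [← form_br_right, hσ', h, map_add, form_br_right, form_br_right, LinearMap.add_apply,
      map_add, LinearMap.add_apply, Module.End.mul_apply, Module.End.mul_apply, beta_adj]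
  -- Multiply `key` by u and take traces: the two terms on the right have equal trace, since
  -- adjoints do.
  have htr : ∀ u v, -D.form v (σ u) * Module.finrank K W =
      2 * LinearMap.trace K W (ρ * (D.cl u * D.cl v)) := by
    intro u v
    rw [← hσ', ← trace_cl_mul_cl, key, add_mul, map_add,
      trace_eq_of_isAdjointPair D.beta_nondegenerate (f := D.adj ρ * D.cl v * D.cl u)
        (g := D.cl u * D.cl v * ρ) (fun s t => by
          simp only [Module.End.mul_apply, beta_adj, beta_cl_cl]),
      LinearMap.trace_mul_comm K (D.cl u * D.cl v) ρ, mul_assoc, LinearMap.trace_mul_comm,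
      mul_assoc]
    ring
  -- Adding `htr` to its swap replaces uv + vu by −2(u, v), leaving only the trace of ρ.
  refine ⟨4 * LinearMap.trace K W ρ / Module.finrank K W, fun u v => ?_⟩
  have h1 := htr u v
  have h2 := htr v u
  have h3 := congrArg (fun f => LinearMap.trace K W (ρ * f)) (D.cl_mul_add_swap u v)
  simp only [mul_add, map_add, mul_smul_comm, map_smul, mul_one, smul_eq_mul] at h3
  rw [D.form_symm (σ u) v]
  field_simp
  linear_combination -h1 - h2 - 2 * h3

/-- A derivation of degree zero vanishing on `V` commutes with even Clifford elements. -/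
theorem commute_of_br_eq_zero {ρ : Module.End K W}
    (h : ∀ s t, D.br (ρ s) t + D.br s (ρ t) = 0) {u : V} (hu : D.form u u ≠ 0) (v : V) :
    ρ * (D.cl u * D.cl v) = D.cl u * D.cl v * ρ := by
  have key : ∀ v, D.adj ρ * D.cl v = -(D.cl v * ρ) := by
    refine fun v => D.end_eq_of_beta fun s t => ?_
    have := congrArg (D.form v) (h s t)
    rw [map_add, form_br_right, form_br_right, map_zero] at this
    rw [Module.End.mul_apply, beta_adj, LinearMap.neg_apply, map_neg, LinearMap.neg_apply,
      Module.End.mul_apply]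
    exact eq_neg_of_add_eq_zero_right this
  -- Multiplying ρ*u = −uρ by u on both sides and cancelling u² = −(u, u) ≠ 0 gives uρ* = −ρu. Hence
  -- uvρ = −uρ*v = ρuv.
  have hu' : D.cl u * D.adj ρ = -(ρ * D.cl u) := by
    have h1 : D.cl u * (D.adj ρ * D.cl u) * D.cl u = D.cl u * D.adj ρ * (D.cl u * D.cl u) := by
      simp only [mul_assoc]
    rw [key, cl_mul_self, mul_neg, ← mul_assoc, cl_mul_self, mul_smul_comm, mul_one, smul_mul_assoc,
      one_mul, ← smul_neg, smul_mul_assoc, neg_mul] at h1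
    exact (smul_right_injective _ (neg_ne_zero.2 hu) h1).symm
  rw [mul_assoc, show D.cl v * ρ = -(D.adj ρ * D.cl v) by rw [key, neg_neg], mul_neg, ← mul_assoc,
    ← mul_assoc, hu', neg_mul, neg_neg]

end Datum

end Clifford

end ExtTranslation
end

noncomputable section

namespace ExtTranslation

/-! ### Transitive prolongations of extended translation algebras -/

section Transitive

variable {K V W : Type*} [RCLike K] [AddCommGroup V] [Module K V]
  [AddCommGroup W] [Module K W]

theorem Datum.grading_eq_bot (D : Datum K V W) (p : ℤ) (h1 : p ≠ -1) (h2 : p ≠ -2) :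
    D.grading p = ⊥ :=
  (Submodule.eq_bot_iff _).2 fun _ hx =>
    have h := D.mem_grading.1 hx
    Prod.ext (h.1 h2) (h.2 h1)

variable [FiniteDimensional K V]

/-- A graded Lie algebra of depth two with `V` and `W` as negative components, whose bracket
restricts to that of `𝔪`, and which is transitive. -/
structure Realization (D : Datum K V W) {L : Type*} [LieRing L] [LieAlgebra K L]
    (𝓛 : ℤ → Submodule K L) where
  inV : V →ₗ[K] L
  inW : W →ₗ[K] L
  projV : L →ₗ[K] V
  projW : L →ₗ[K] W
  projV_inV : ∀ v, projV (inV v) = v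
  projW_inW : ∀ s, projW (inW s) = s
  inV_mem : ∀ v, inV v ∈ 𝓛 (-2)
  inW_mem : ∀ s, inW s ∈ 𝓛 (-1)
  inV_projV : ∀ X ∈ 𝓛 (-2), inV (projV X) = X
  inW_projW : ∀ X ∈ 𝓛 (-1), inW (projW X) = X
  lie_inW : ∀ s t, ⁅inW s, inW t⁆ = inV (D.br s t)
  lie_inV : ∀ u v, ⁅inV u, inV v⁆ = 0
  lie_inV_inW : ∀ v s, ⁅inV v, inW s⁆ = 0
  transitive : ∀ p : ℤ, 0 ≤ p → ∀ X ∈ 𝓛 p, (∀ s, ⁅X, inW s⁆ = 0) → X = 0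

theorem IsTransitiveProlongation.nonempty_realization {D : Datum K V W} {L : Type*} [LieRing L]
    [LieAlgebra K L] {𝓛 : ℤ → Submodule K L} [GradedLieAlgebra 𝓛]
    (h : IsTransitiveProlongation D.grading 𝓛) : Nonempty (Realization D 𝓛) := by
  obtain ⟨j, hinj, h1, h2⟩ := h.negative
  let a : V →ₗ[K] L := (j : D.Alg →ₗ[K] L) ∘ₗ (D.grading (-2)).subtype ∘ₗ D.inV
  let b : W →ₗ[K] L := (j : D.Alg →ₗ[K] L) ∘ₗ (D.grading (-1)).subtype ∘ₗ D.inW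
  have ha : Function.Injective a := hinj.comp (Subtype.val_injective.comp fun u v huv =>
    congrArg (fun x : D.grading (-2) => x.1.1) huv)
  have hb : Function.Injective b := hinj.comp (Subtype.val_injective.comp fun u v huv =>
    congrArg (fun x : D.grading (-1) => x.1.2) huv)
  have ham : ∀ v, a v ∈ 𝓛 (-2) := fun v => h2 ▸ Submodule.mem_map_of_mem (D.inV v).2
  have hbm : ∀ v, b v ∈ 𝓛 (-1) := fun v => h1 ▸ Submodule.mem_map_of_mem (D.inW v).2
  obtain ⟨f, hf⟩ := LinearMap.exists_leftInverse_of_injective a (LinearMap.ker_eq_bot.2 ha)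
  obtain ⟨g, hg⟩ := LinearMap.exists_leftInverse_of_injective b (LinearMap.ker_eq_bot.2 hb)
  have hf' : ∀ v, f (a v) = v := LinearMap.congr_fun hf
  have hg' : ∀ v, g (b v) = v := LinearMap.congr_fun hg
  have has : ∀ X ∈ 𝓛 (-2), ∃ v, a v = X := by
    intro X hX
    obtain ⟨x, hx, rfl⟩ := h2 ▸ hX
    exact ⟨x.1, congrArg j (Prod.ext rfl ((D.mem_grading.1 hx).2 (by norm_num)).symm)⟩
  have hbs : ∀ X ∈ 𝓛 (-1), ∃ v, b v = X := by
    intro X hX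
    obtain ⟨x, hx, rfl⟩ := h1 ▸ hX
    exact ⟨x.2, congrArg j (Prod.ext ((D.mem_grading.1 hx).1 (by norm_num)).symm rfl)⟩
  have hzero : ∀ p q X Y, X ∈ 𝓛 p → Y ∈ 𝓛 q → p + q < -2 → ⁅X, Y⁆ = 0 := by
    intro p q X Y hX hY hpq
    have := SetLike.GradedBracket.bracket_mem hX hY
    rwa [h.depth _ hpq, Submodule.mem_bot] at this
  refine ⟨⟨a, b, f, g, hf', hg', ham, hbm, fun X hX => ?_, fun X hX => ?_, fun s t => ?_,
    fun u v => hzero _ _ _ _ (ham u) (ham v) (by norm_num),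
    fun u v => hzero _ _ _ _ (ham u) (hbm v) (by norm_num), fun p hp X hX hs => ?_⟩⟩
  · obtain ⟨v, rfl⟩ := has X hX
    rw [hf']
  · obtain ⟨v, rfl⟩ := hbs X hX
    rw [hg']
  · exact (j.map_lie _ _).symm
  · refine h.transitive p hp X hX fun w hw => ?_
    obtain ⟨s, rfl⟩ := hbs w hw
    exact hs s

/-! ### Vanishing theorems in positive degree -/

namespace Realization

variable {D : Datum K V W} {L : Type*} [LieRing L] [LieAlgebra K L]
  {𝓛 : ℤ → Submodule K L} (R : Realization D 𝓛)

theorem lie_lie_comm {L : Type*} [LieRing L] {x y : L} (h : ⁅x, y⁆ = 0) (X : L) :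
    ⁅⁅X, x⁆, y⁆ = ⁅⁅X, y⁆, x⁆ := by
  have := leibniz_lie X x y
  rw [h, lie_zero, ← lie_skew x, ← sub_eq_add_neg] at this
  exact sub_eq_zero.1 this.symm

theorem lie_lie_sub {L : Type*} [LieRing L] (X x y : L) :
    ⁅⁅X, x⁆, y⁆ - ⁅⁅X, y⁆, x⁆ = ⁅X, ⁅x, y⁆⁆ := by
  rw [leibniz_lie X x y, ← lie_skew x, ← sub_eq_add_neg]

theorem lie_inW_inV (s : W) (v : V) : ⁅R.inW s, R.inV v⁆ = 0 := by
  rw [← lie_skew, R.lie_inV_inW, neg_zero]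

/-- The action of elements of degree zero on `W`. -/
def rho : L →ₗ[K] Module.End K W :=
  LinearMap.mk₂ K (fun X s => R.projW ⁅X, R.inW s⁆) (by simp) (by simp) (by simp) (by simp)

/-- The action of elements of degree zero on `V`. -/
def sigma : L →ₗ[K] Module.End K V :=
  LinearMap.mk₂ K (fun X v => R.projV ⁅X, R.inV v⁆) (by simp) (by simp) (by simp) (by simp)

theorem sigma_apply (X : L) (v : V) : R.sigma X v = R.projV ⁅X, R.inV v⁆ := rfl

theorem inV_injective : Function.Injective R.inV := fun u v h => by
  rw [← R.projV_inV u, h, R.projV_inV]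

variable [GradedLieAlgebra 𝓛]

theorem lie_inW_mem {p : ℤ} {X : L} (hX : X ∈ 𝓛 p) (s : W) : ⁅X, R.inW s⁆ ∈ 𝓛 (p - 1) :=
  SetLike.GradedBracket.bracket_mem hX (R.inW_mem s)

theorem lie_inV_mem {p : ℤ} {X : L} (hX : X ∈ 𝓛 p) (v : V) : ⁅X, R.inV v⁆ ∈ 𝓛 (p - 2) :=
  SetLike.GradedBracket.bracket_mem hX (R.inV_mem v)

theorem inW_rho {X : L} (hX : X ∈ 𝓛 0) (s : W) : R.inW (R.rho X s) = ⁅X, R.inW s⁆ :=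
  R.inW_projW _ (R.lie_inW_mem hX s)

theorem inV_sigma {X : L} (hX : X ∈ 𝓛 0) (v : V) : R.inV (R.sigma X v) = ⁅X, R.inV v⁆ :=
  R.inV_projV _ (R.lie_inV_mem hX v)

theorem sigma_br {X : L} (hX : X ∈ 𝓛 0) (s t : W) :
    R.sigma X (D.br s t) = D.br (R.rho X s) t + D.br s (R.rho X t) := by
  apply R.inV_injective
  rw [map_add, R.inV_sigma hX, ← R.lie_inW, ← R.lie_inW, ← R.lie_inW, R.inW_rho hX,
    R.inW_rho hX, leibniz_lie]

variable [FiniteDimensional K W]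

theorem rho_commute {X : L} (hX : X ∈ 𝓛 0) (h : ∀ v, ⁅X, R.inV v⁆ = 0) {u : V}
    (hu : D.form u u ≠ 0) (v : V) :
    R.rho X * (D.cl u * D.cl v) = D.cl u * D.cl v * R.rho X :=
  D.commute_of_br_eq_zero (fun s t => by
    rw [← R.sigma_br hX, sigma_apply, h, map_zero]) hu v

variable {e : Fin 3 → V}

/-- In positive degree only zero commutes with `V`. -/
theorem eq_zero_of_lie_inV (he : ∀ i, D.form (e i) (e i) ≠ 0)
    (heo : ∀ i j, i ≠ j → D.form (e i) (e j) = 0) {p : ℤ} (hp : 0 < p) {X : L} (hX : X ∈ 𝓛 p)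
    (h : ∀ v, ⁅X, R.inV v⁆ = 0) : X = 0 := by
  induction p, (show (1 : ℤ) ≤ p from hp) using Int.leInduction generalizing X with
  | base =>
    have hs : ∀ s v, ⁅⁅X, R.inW s⁆, R.inV v⁆ = 0 := fun s v => by
      rw [lie_lie_comm (R.lie_inW_inV s v), h, zero_lie]
    have hmem : ∀ s, ⁅X, R.inW s⁆ ∈ 𝓛 0 := R.lie_inW_mem hX
    refine R.transitive 1 (by norm_num) X hX fun s =>
      R.transitive 0 le_rfl _ (hmem s) fun t => ?_
    rw [← R.inW_rho (hmem s)]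
    -- Symmetry of Φ comes from [X, [s, t]] = 0, since [s, t] ∈ V.
    have := D.first_prolongation_eq_zero he heo (Φ := fun s => R.rho ⁅X, R.inW s⁆)
      (fun s t => congrArg R.projW (by
        rw [← sub_eq_zero, lie_lie_sub, R.lie_inW, h]))
      (fun s u v hu => R.rho_commute (hmem s) (hs s) hu v) s t
    rw [this, map_zero]
  | succ p hp1 ih =>
    refine R.transitive _ hp.le X hX fun s => ih (by omega) ?_ fun v => ?_
    · simpa using R.lie_inW_mem hX s
    · rw [lie_lie_comm (R.lie_inW_inV s v), h, zero_lie]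

variable [Nontrivial W]

theorem conformal {X : L} (hX : X ∈ 𝓛 0) :
    ∃ c, ∀ u v, D.form (R.sigma X u) v + D.form u (R.sigma X v) = c * D.form u v :=
  D.exists_conformal (R.sigma_br hX)

/-- An element of degree two that maps `V` to elements commuting with `V` vanishes. -/
theorem eq_zero_of_lie_lie_inV (he : ∀ i, D.form (e i) (e i) ≠ 0)
    (heo : ∀ i j, i ≠ j → D.form (e i) (e j) = 0) {Y : L} (hY : Y ∈ 𝓛 2)
    (h : ∀ u v, ⁅⁅Y, R.inV u⁆, R.inV v⁆ = 0) : Y = 0 := by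
  have hmem : ∀ v, ⁅Y, R.inV v⁆ ∈ 𝓛 0 := R.lie_inV_mem hY
  let H : V → Module.End K W := fun v => R.rho ⁅Y, R.inV v⁆
  have hcomm : ∀ x u v, D.form u u ≠ 0 → H x * (D.cl u * D.cl v) = D.cl u * D.cl v * H x :=
    fun x u v hu => R.rho_commute (hmem x) (h x) hu v
  -- Since V commutes with W, the bracket with v can be taken first; this expresses the action on V
  -- of a degree 0 element through H.
  have hsig : ∀ s t v, R.sigma ⁅⁅Y, R.inW s⁆, R.inW t⁆ v = D.br (H v s) t := by
    intro s t v
    rw [sigma_apply, lie_lie_comm (R.lie_inW_inV t v), lie_lie_comm (R.lie_inW_inV s v),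
      ← R.inW_rho (hmem v), R.lie_inW, R.projV_inV]
  have hc : ∀ s t, ∃ c, ∀ u v, D.beta ((D.cl u * H v + D.cl v * H u) s) t = c * D.form u v := by
    intro s t
    have h0 : ⁅⁅Y, R.inW s⁆, R.inW t⁆ ∈ 𝓛 0 := R.lie_inW_mem (p := 1) (R.lie_inW_mem hY s) t
    obtain ⟨c, hc⟩ := R.conformal h0
    refine ⟨c, fun u v => ?_⟩
    rw [← hc, hsig, hsig, D.form_br, D.form_br_right, LinearMap.add_apply, map_add,
      LinearMap.add_apply, add_comm]
    rfl
  -- Each c(s, t) is recovered from u = v = e₀, so these scalars are the matrix entries of a single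
  -- endomorphism Λ.
  have hΛ : ∀ u v, D.cl u * H v + D.cl v * H u = D.form u v •
      ((D.form (e 0) (e 0))⁻¹ • (D.cl (e 0) * H (e 0) + D.cl (e 0) * H (e 0))) := by
    refine fun u v => D.end_eq_of_beta fun s t => ?_
    obtain ⟨c, hc⟩ := hc s t
    rw [hc, LinearMap.smul_apply, LinearMap.smul_apply, map_smul, map_smul, LinearMap.smul_apply,
      LinearMap.smul_apply, hc, smul_eq_mul, smul_eq_mul]
    field_simp [he 0]
  refine R.eq_zero_of_lie_inV he heo (by norm_num) hY fun v =>
    R.transitive 0 le_rfl _ (hmem v) fun s => ?_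
  rw [← R.inW_rho (hmem v), show R.rho ⁅Y, R.inV v⁆ = 0 from
    D.eq_zero_of_cl_mul_add he heo hΛ hcomm v, LinearMap.zero_apply, map_zero]

/-- Degree 4 is the one in which two brackets with V reach degree 0, so that a third yields an
element of the second prolongation of 𝔠𝔬(V). -/
theorem eq_zero_of_mem_four (R : Realization D 𝓛) (he : ∀ i, D.form (e i) (e i) ≠ 0)
    (heo : ∀ i j, i ≠ j → D.form (e i) (e j) = 0) {X : L} (hX : X ∈ 𝓛 4) : X = 0 := by
  have hmem2 : ∀ u, ⁅X, R.inV u⁆ ∈ 𝓛 2 := R.lie_inV_mem hX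
  have hmem : ∀ u v, ⁅⁅X, R.inV u⁆, R.inV v⁆ ∈ 𝓛 0 := fun u => R.lie_inV_mem (hmem2 u)
  have hT := D.second_prolongation_eq_zero he heo
    (T := fun u v w => R.sigma ⁅⁅X, R.inV u⁆, R.inV v⁆ w)
    (fun u v w => by rw [lie_lie_comm (R.lie_inV u v)])
    (fun u v w => congrArg R.projV (lie_lie_comm (R.lie_inV v w) _))
    (fun u v => R.conformal (hmem u v))
  refine R.eq_zero_of_lie_inV he heo (by norm_num) hX fun u =>
    R.eq_zero_of_lie_lie_inV he heo (hmem2 u) fun v w => ?_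
  rw [← R.inV_sigma (hmem u v), hT, map_zero]

theorem eq_bot_of_four_le (R : Realization D 𝓛) (he : ∀ i, D.form (e i) (e i) ≠ 0)
    (heo : ∀ i j, i ≠ j → D.form (e i) (e j) = 0) {p : ℤ} (hp : 4 ≤ p) : 𝓛 p = ⊥ := by
  induction p, hp using Int.leInduction with
  | base => exact (Submodule.eq_bot_iff _).2 fun X hX => R.eq_zero_of_mem_four he heo hX
  | succ p hp ih =>
    refine (Submodule.eq_bot_iff _).2 fun X hX => R.transitive _ (by omega) X hX fun s => ?_
    have := R.lie_inW_mem hX s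
    rwa [add_sub_cancel_right, ih, Submodule.mem_bot] at this

end Realization

theorem finiteDimensional_of_grading {L : Type*} [AddCommGroup L] [Module K L]
    (𝓛 : ℤ → Submodule K L) [DirectSum.Decomposition 𝓛] (hfin : ∀ p, FiniteDimensional K (𝓛 p))
    {a b : ℤ} (ha : ∀ p < a, 𝓛 p = ⊥) (hb : ∀ p, b ≤ p → 𝓛 p = ⊥) : FiniteDimensional K L := by
  have htop : ⨆ p : Set.Ico a b, 𝓛 p = ⊤ := by
    rw [← (DirectSum.Decomposition.isInternal 𝓛).submodule_iSup_eq_top]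
    refine le_antisymm (iSup_le fun p => le_iSup 𝓛 p) (iSup_le fun p => ?_)
    rcases lt_or_ge p a with h | h
    · simp [ha p h]
    rcases lt_or_ge p b with h' | h'
    · exact le_iSup (fun p : Set.Ico a b => 𝓛 p) ⟨p, h, h'⟩
    · simp [hb p h']
  have : FiniteDimensional K (⊤ : Submodule K L) := htop ▸ Submodule.finiteDimensional_iSup _
  exact Module.finite_def.2 ((Submodule.fg_top _).1 (Module.finite_def.1 this))

end Transitive

theorem Datum.grading_generated {K V W : Type*} [RCLike K] [AddCommGroup V] [Module K V]
    [FiniteDimensional K V] [AddCommGroup W] [Module K W] [Nontrivial W] (D : Datum K V W) :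
    D.grading (-2) ≤ Submodule.span K
      {z | ∃ x ∈ D.grading (-1), ∃ y ∈ D.grading (-1), ⁅x, y⁆ = z} := by
  let f : V →ₗ[K] D.Alg := (D.grading (-2)).subtype ∘ₗ D.inV
  intro x hx
  have hfx : f x.1 = x := Prod.ext rfl ((D.mem_grading.1 hx).2 (by norm_num)).symm
  have hle : Submodule.span K {x : V | ∃ s t, D.br s t = x} ≤ (Submodule.span K
      {z | ∃ x ∈ D.grading (-1), ∃ y ∈ D.grading (-1), ⁅x, y⁆ = z}).comap f := by
    refine Submodule.span_le.2 ?_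
    rintro _ ⟨s, t, rfl⟩
    exact Submodule.subset_span ⟨_, (D.inW s).2, _, (D.inW t).2, rfl⟩
  rw [D.span_br] at hle
  rw [← hfx]
  exact hle Submodule.mem_top

end ExtTranslation
end

theorem theorem2p2 {K : Type u} {V : Type v} {W : Type w} [RCLike K]
    [AddCommGroup V] [Module K V] [FiniteDimensional K V]
    [AddCommGroup W] [Module K W] [FiniteDimensional K W] [Nontrivial W]
    (D : ExtTranslation.Datum K V W) (hV : 3 ≤ Module.finrank K V) :
    (∃ (G : Type (max v w)) (_ : LieRing G) (_ : LieAlgebra K G) (𝓖 : ℤ → Submodule K G)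
        (_ : GradedLieAlgebra 𝓖),
        ExtTranslation.IsMaximalTransitiveProlongation D.grading 𝓖) ∧
      ∀ (G : Type x) [LieRing G] [LieAlgebra K G] (𝓖 : ℤ → Submodule K G) [GradedLieAlgebra 𝓖],
        ExtTranslation.IsMaximalTransitiveProlongation D.grading 𝓖 →
          FiniteDimensional K G ∧
            ∀ p : ℤ, 0 < p → ∀ X ∈ 𝓖 p, (∀ Y ∈ 𝓖 (-2), ⁅X, Y⁆ = 0) → X = 0 := by
  refine ⟨⟨ExtTranslation.prolongation D.grading, _, _, ExtTranslation.prolongGrading D.grading, _,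
    ExtTranslation.prolongation_isMaximal D.grading_eq_bot D.grading_generated fun p => ?_⟩,
    fun G _ _ 𝓖 _ h => ?_⟩
  · have : FiniteDimensional K D.Alg := inferInstanceAs (FiniteDimensional K (V × W))
    infer_instance
  · obtain ⟨R⟩ := h.toIsTransitiveProlongation.nonempty_realization
    obtain ⟨e, he, heo⟩ := D.exists_orthogonal_triple hV
    refine ⟨ExtTranslation.finiteDimensional_of_grading 𝓖 h.finite h.depth
      fun p hp => R.eq_bot_of_four_le he heo hp, fun p hp X hX hY => ?_⟩
    exact R.eq_zero_of_lie_inV he heo hp hX fun v => hY _ (R.inV_mem v)
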